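/- Let $N\ge 0$, let $\lambda_1,\dots,\lambda_N\in\mathbb{C}$ be pairwise distinct, let $a_i,b_i\in\mathbb{C}$, and let $G\subset\mathbb{C}$ be a bounded measurable set with $\lambda_i\notin\overline G$ for all $i$. Let $\mathbf{x}=(x_1,\dots,x_N)$ vary in an open set $U\subset\mathbb{K}^N$, where $\mathbb{K}=\mathbb{R}$ or $\mathbb{K}=\mathbb{C}$, and put $$S^1_0=\sum_{i=1}^N\frac{a_ix_i}{\lambda-\lambda_i},\qquad S^2_0=\sum_{i=1}^N\frac{b_ix_i}{\lambda-\lambda_i}.$$ Let $W(\lambda,\bar\lambda;s^1,s^2)$ be a function on (the part over $G$ of) an open set $D\subset\mathbb{C}\times\mathbb{C}^2$, measurable, bounded on the part over $G$ of each compact subset of $D$, and, for each $\lambda\in G$, holomorphic in $(s^1,s^2)$; write $W_{,k}=\partial W/\partial s^k$. Let $S^k=S^k_0+\widetilde S^k$ ($k=1,2$), where $\widetilde S^k(\mathbf{x},\lambda)$ is defined and continuous on $U\times\mathbb{C}$, is continuously differentiable in $\mathbf{x}$ with $\mathbf{x}$-derivative continuous in $(\mathbf{x},\lambda)$, is analytic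 in $\lambda$ outside $\overline G$ and tends to $0$ as $\lambda\to\infty$, and where $(\lambda,S^1,S^2)\in D$ for $\mathbf{x}\in U$, $\lambda\in\overline G$. Suppose that for every $\mathbf{x}\in U$ these functions solve the nonlinear $\bar\partial$-problem $$\bar\partial S^1=W_{,2}(\lambda,\bar\lambda;S^1,S^2),\qquad \bar\partial S^2=-W_{,1}(\lambda,\bar\lambda;S^1,S^2)\qquad\text{in } G,$$ in the sense that, as distributions on $\mathbb{C}$, $\bar\partial\widetilde S^1=\mathbf 1_G\,W_{,2}(\lambda,\bar\lambda;S^1,S^2)$ and $\bar\partial\widetilde S^2=-\mathbf 1_G\,W_{,1}(\lambda,\bar\lambda;S^1,S^2)$. Then for $\mathbf{x}\in U$ the integral in $$\Theta(\mathbf{x})=\frac12\sum_{i\ne j}\frac{a_ib_j-a_jb_i}{\lambda_i-\lambda_j}x_ix_j+\frac{1}{2\pi\mathrm{i}}\iint_G\Bigl(\widetilde S^2\,\bar\partial\widetilde S^1-W(\lambda,\bar\lambda;S^1,S^2)\Bigr)\,d\lambda\wedge d\bar\lambda$$ converges absolutely, $\Theta$ is twice continuously differentiable on $U$ over $\mathbb{K}$,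 and, with subscripts denoting partial derivatives in $\mathbf{x}$, the following hold on $U$. (1) $\Theta$ is a potential of the two-form $dS^1\wedge dS^2$: for all $i,j$ and all $\lambda\in\mathbb{C}\setminus\{\lambda_1,\dots,\lambda_N\}$, $$S^1_{,i}S^2_{,j}-S^1_{,j}S^2_{,i}=\Bigl(\frac1{\lambda-\lambda_i}-\frac1{\lambda-\lambda_j}\Bigr)\Theta_{,ij}.$$ (2) $\Theta$ solves the hierarchy of general heavenly equations: for any four pairwise distinct indices $i,j,k,l$, $$(\lambda_k-\lambda_j)(\lambda_l-\lambda_i)\Theta_{,jk}\Theta_{,il}-(\lambda_k-\lambda_i)(\lambda_l-\lambda_j)\Theta_{,ik}\Theta_{,jl}+(\lambda_j-\lambda_i)(\lambda_l-\lambda_k)\Theta_{,ij}\Theta_{,kl}=0.$$ -/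

import Mathlib

open Set Filter Topology MeasureTheory
open scoped ContDiff

namespace HeavenlyDressing

/-- The Wirtinger derivative `∂φ/∂z̄ = (∂φ/∂x + i ∂φ/∂y) / 2` of a real-differentiable `φ`. -/
noncomputable def dbar (φ : ℂ → ℂ) (z : ℂ) : ℂ :=
  (1 / 2) * (fderiv ℝ φ z 1 + Complex.I * fderiv ℝ φ z Complex.I)

/-- `∂̄ u = g` on the whole plane, in the sense of distributions. -/
def HasWeakDbar (u g : ℂ → ℂ) : Prop :=
  LocallyIntegrable u ∧ LocallyIntegrable g ∧
    ∀ φ : ℂ → ℂ, ContDiff ℝ ∞ φ → HasCompactSupport φ →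
      ∫ z, u z * dbar φ z = - ∫ z, g z * φ z

open Classical in
/-- The distributional derivative `∂̄ u` when it is a locally integrable function (it is then unique
up to equality almost everywhere). -/
noncomputable def weakDbar (u : ℂ → ℂ) : ℂ → ℂ :=
  if h : ∃ g, HasWeakDbar u g then h.choose else 0

/-- `∬_G F dz ∧ dz̄`, where `dz ∧ dz̄ = -2i dx ∧ dy`. -/
noncomputable def wedgeIntegral (G : Set ℂ) (F : ℂ → ℂ) : ℂ :=
  ∫ z in G, (-2 * Complex.I) * F z

/-- `W` is a function of `z ∈ G` and `(s₁, s₂)`, defined for `(z, s₁, s₂) ∈ D`: it is measurable,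
locally bounded on `D`, and holomorphic in `(s₁, s₂)`. -/
structure IsHamiltonian (G : Set ℂ) (D : Set (ℂ × ℂ × ℂ)) (W : ℂ → ℂ → ℂ → ℂ) : Prop where
  isOpen_domain : IsOpen D
  measurable : Measurable
    ((D ∩ {p | p.1 ∈ G}).indicator fun p : ℂ × ℂ × ℂ => W p.1 p.2.1 p.2.2)
  locally_bounded : ∀ K ⊆ D, IsCompact K →
    ∃ C : ℝ, ∀ p ∈ K, p.1 ∈ G → ‖W p.1 p.2.1 p.2.2‖ ≤ C
  holomorphic : ∀ z ∈ G,
    DifferentiableOn ℂ (fun s : ℂ × ℂ => W z s.1 s.2) {s | (z, s.1, s.2) ∈ D}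

section Parameters

variable {𝕜 : Type*} [RCLike 𝕜] [NormedAlgebra 𝕜 ℂ] {N : ℕ}

/-- The partial derivative `∂F/∂x_i`. -/
noncomputable def pd (i : Fin N) (F : (Fin N → 𝕜) → ℂ) (x : Fin N → 𝕜) : ℂ :=
  fderiv 𝕜 F x (Pi.single i 1)

/-- The vacuum term `∑ i, c_i x_i / (z - p_i)`. -/
noncomputable def vacuum (p c : Fin N → ℂ) (x : Fin N → 𝕜) (z : ℂ) : ℂ :=
  ∑ i, x i • (c i / (z - p i))

/-- The vacuum potential `Θ₀ = (1/2) ∑_{i ≠ j} (a_i b_j - a_j b_i) / (p_i - p_j) x_i x_j`. -/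
noncomputable def vacuumPotential (p a b : Fin N → ℂ) (x : Fin N → 𝕜) : ℂ :=
  (1 / 2) * ∑ i, ∑ j ∈ Finset.univ.erase i,
    (x i * x j) • ((a i * b j - a j * b i) / (p i - p j))

/-- Continuous dependence on `(x, z)`, together with the first derivatives in `x`. -/
structure IsC1Family (U : Set (Fin N → 𝕜)) (T : (Fin N → 𝕜) → ℂ → ℂ) : Prop where
  continuousOn : ContinuousOn (fun q : (Fin N → 𝕜) × ℂ => T q.1 q.2) (U ×ˢ univ)
  differentiableAt : ∀ x ∈ U, ∀ z : ℂ, DifferentiableAt 𝕜 (fun y => T y z) x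
  continuousOn_fderiv : ContinuousOn
    (fun q : (Fin N → 𝕜) × ℂ => fderiv 𝕜 (fun y => T y q.2) q.1) (U ×ˢ univ)

/-- `S₁ = vacuum p a + T₁` and `S₂ = vacuum p b + T₂`, for `x ∈ U`, solve the nonlinear
`∂̄`-problem `∂̄ S₁ = ∂W/∂S₂`, `∂̄ S₂ = -∂W/∂S₁` in `G`, where `T₁`, `T₂` are analytic outside `G`
and tend to zero at infinity. The vacuum terms are analytic in `G`, so that `∂̄ S_k = ∂̄ T_k` there;
the equation for `T_k` is on the whole plane, with right-hand side zero outside `G`. -/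
structure IsDbarSolution (G : Set ℂ) (D : Set (ℂ × ℂ × ℂ)) (W : ℂ → ℂ → ℂ → ℂ)
    (p a b : Fin N → ℂ) (U : Set (Fin N → 𝕜)) (T₁ T₂ : (Fin N → 𝕜) → ℂ → ℂ) : Prop where
  family₁ : IsC1Family U T₁
  family₂ : IsC1Family U T₂
  mem_domain : ∀ x ∈ U, ∀ z ∈ closure G,
    (z, vacuum p a x z + T₁ x z, vacuum p b x z + T₂ x z) ∈ D
  dbar₁ : ∀ x ∈ U, HasWeakDbar (T₁ x) (G.indicator fun z =>
    deriv (fun s => W z (vacuum p a x z + T₁ x z) s) (vacuum p b x z + T₂ x z))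
  dbar₂ : ∀ x ∈ U, HasWeakDbar (T₂ x) (G.indicator fun z =>
    - deriv (fun s => W z s (vacuum p b x z + T₂ x z)) (vacuum p a x z + T₁ x z))
  analytic₁ : ∀ x ∈ U, DifferentiableOn ℂ (T₁ x) (closure G)ᶜ
  analytic₂ : ∀ x ∈ U, DifferentiableOn ℂ (T₂ x) (closure G)ᶜ
  zero_at_infty₁ : ∀ x ∈ U, Tendsto (T₁ x) (cocompact ℂ) (𝓝 0)
  zero_at_infty₂ : ∀ x ∈ U, Tendsto (T₂ x) (cocompact ℂ) (𝓝 0)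

/-- The density `T₂ ∂̄ T₁ - W(z, S₁, S₂)` of the action, with `S_k = V_k + T_k`. -/
noncomputable def actionDensity (W : ℂ → ℂ → ℂ → ℂ) (V₁ V₂ T₁ T₂ : ℂ → ℂ) (z : ℂ) : ℂ :=
  T₂ z * weakDbar T₁ z - W z (V₁ z + T₁ z) (V₂ z + T₂ z)

/-- The action `(1 / 2πi) ∬_G (T₂ ∂̄ T₁ - W(z, S₁, S₂)) dz ∧ dz̄`. -/
noncomputable def action (G : Set ℂ) (W : ℂ → ℂ → ℂ → ℂ) (V₁ V₂ T₁ T₂ : ℂ → ℂ) : ℂ :=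
  1 / (2 * Real.pi * Complex.I) * wedgeIntegral G (actionDensity W V₁ V₂ T₁ T₂)

/-- The function `Θ`: the vacuum potential plus the action evaluated at `T₁`, `T₂`. -/
noncomputable def potential (G : Set ℂ) (W : ℂ → ℂ → ℂ → ℂ) (p a b : Fin N → ℂ)
    (T₁ T₂ : (Fin N → 𝕜) → ℂ → ℂ) (x : Fin N → 𝕜) : ℂ :=
  vacuumPotential p a b x + action G W (vacuum p a x) (vacuum p b x) (T₁ x) (T₂ x)

/-- `Θ` satisfies the hierarchy of general heavenly equations at `x`. -/
def SolvesHeavenlyHierarchyAt (p : Fin N → ℂ) (Θ : (Fin N → 𝕜) → ℂ) (x : Fin N → 𝕜) : Prop :=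
  ∀ i j k l : Fin N, i ≠ j → i ≠ k → i ≠ l → j ≠ k → j ≠ l → k ≠ l →
    (p k - p j) * (p l - p i) * pd j (pd k Θ) x * pd i (pd l Θ) x
      - (p k - p i) * (p l - p j) * pd i (pd k Θ) x * pd j (pd l Θ) x
      + (p j - p i) * (p l - p k) * pd i (pd j Θ) x * pd k (pd l Θ) x = 0

/-- The coefficients of the two-form `dS₁ ∧ dS₂` at `x` and `z` are
`(1 / (z - p_i) - 1 / (z - p_j)) ∂²Θ/∂x_i∂x_j`. -/
def IsPotentialOfTwoFormAt (p : Fin N → ℂ) (S₁ S₂ : (Fin N → 𝕜) → ℂ → ℂ)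
    (Θ : (Fin N → 𝕜) → ℂ) (x : Fin N → 𝕜) (z : ℂ) : Prop :=
  ∀ i j : Fin N,
    pd i (fun y => S₁ y z) x * pd j (fun y => S₂ y z) x
      - pd j (fun y => S₁ y z) x * pd i (fun y => S₂ y z) x
    = (1 / (z - p i) - 1 / (z - p j)) * pd i (pd j Θ) x

end Parameters

end HeavenlyDressing

/-!
Write `C f(w) = (1/π) ∬ f(z) / (w - z) dx dy` for the Cauchy transform. Everything follows from the
fact that a continuous `T` which vanishes at infinity and satisfies `∂̄ T = f` weakly, with `f`
bounded and of bounded support, equals `C f` everywhere (`HasWeakDbar.eq_cauchyTransform`). The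
argument can then be carried out with absolutely convergent integrals, with two properties of the
kernel in place of partial integration: `C` is antisymmetric
(`IsBoundedCompact.integral_mul_cauchyTransform`), and it satisfies the product rule `C f · C g = C
(f · C g) + C (g · C f)` (`IsBoundedCompact.cauchyTransform_mul_cauchyTransform`).

Cauchy estimates for `W` on compact subsets of `D` (`IsHamiltonian.exists_bound`) allow one to
differentiate `T_k = C f_k` with respect to the parameters under the integral sign, where `f₁`,
`f₂` are the right hand sides of the `∂̄`-problem (`IsDbarSolution.fderiv_eq_cauchyTransform`).

*The gradient of `Θ`.* In the variation of the action `f₁ δT₂` cancels outright, `T₂ δf₁` and `f₂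
δT₁` cancel by antisymmetry, and what is left is `-(1/π) ∬ (f₂ δV₁ - f₁ δV₂)`, with `V_k` the
vacuum terms. These have poles outside the closure of `G`, so the integral is a combination of
values of `T_k = C f_k` at the poles: `∂Θ/∂x_i = ∂Θ₀/∂x_i + a_i T₂(p_i) - b_i T₁(p_i)`
(`IsDbarSolution.hasDerivAt_action`, `IsDbarSolution.hasFDerivAt_potential`). The right hand side
is continuously differentiable in `x`.

*The two-form.* The linearized equations are Hamiltonian, with the symmetric Hessian of `W`, so the
coefficients of `dS₁ ∧ dS₂` have no `∂̄` in `G` (`IsDbarSolution.sourceDeriv_symplectic`). By the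
product rule the part quadratic in `dT₁`, `dT₂` is then the Cauchy transform of terms with one
vacuum factor, which is explicit, as `C (f / (· - p)) (w) = (C f(w) - C f(p)) / (w - p)`. This
leaves a sum of simple poles at `p_i` and `p_j` whose residues are second derivatives of `Θ`
(`IsDbarSolution.twoForm_eq`).

The heavenly equations are the Plücker relations for the decomposable form `dS₁ ∧ dS₂`, at any one
point `z` which is not a pole.

The normed algebra structure of `ℂ` over `𝕜` is arbitrary, so for `𝕜 = ℂ` it need not be the
standard one; derivatives in the parameters are only ever taken over `𝕜`.
-/

namespace HeavenlyDressing

/-! ### Cauchy estimates in several variables -/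

section Holomorphic

variable {E : Type*} [NormedAddCommGroup E] [NormedSpace ℂ E]

/-- Cauchy's estimate, as a consequence of the Schwarz lemma; the constant is not optimal. -/
theorem norm_fderiv_le_of_norm_le {F : Type*} [NormedAddCommGroup F] [NormedSpace ℂ F]
    {f : E → F} {c : E} {r C : ℝ} (hr : 0 < r)
    (hf : DifferentiableOn ℂ f (Metric.ball c r)) (hC : ∀ s ∈ Metric.ball c r, ‖f s‖ ≤ C) :
    ‖fderiv ℂ f c‖ ≤ (2 * C) / r := by
  refine Complex.norm_fderiv_le_div_of_mapsTo_ball hf (fun s hs => ?_) hr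
  rw [Metric.mem_closedBall, dist_eq_norm]
  have := norm_sub_le (f s) (f c)
  have := hC s hs
  have := hC c (Metric.mem_ball_self hr)
  linarith

theorem fderiv_apply_eq_circleIntegral {f : E → ℂ} {s v : E} {r ρ : ℝ} (hρ : 0 < ρ)
    (hv : ρ * ‖v‖ < r) (hf : DifferentiableOn ℂ f (Metric.ball s r)) :
    fderiv ℂ f s v
      = (2 * Real.pi * Complex.I : ℂ)⁻¹ • ∮ ζ in C(0, ρ), ((ζ - 0) ^ 2)⁻¹ • f (s + ζ • v) := by
  have hr : 0 < r := lt_of_le_of_lt (by positivity) hv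
  -- the line `ζ ↦ s + ζ v` maps a neighbourhood of the closed disc of radius `ρ` into the ball
  let O : Set ℂ := (fun ζ : ℂ => s + ζ • v) ⁻¹' Metric.ball s r
  have hO : IsOpen O := Metric.isOpen_ball.preimage (by fun_prop)
  have hsub : Metric.closedBall (0 : ℂ) ρ ⊆ O := by
    intro ζ hζ
    simp only [O, mem_preimage, Metric.mem_ball, dist_eq_norm, add_sub_cancel_left, norm_smul]
    rw [mem_closedBall_zero_iff] at hζ
    exact lt_of_le_of_lt (by gcongr) hv
  have hd : DifferentiableOn ℂ (fun ζ : ℂ => f (s + ζ • v)) O :=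
    hf.comp (by fun_prop) (fun ζ hζ => hζ)
  rw [Complex.two_pi_I_inv_smul_circleIntegral_sub_sq_inv_smul_of_differentiable hO hsub hd
    (Metric.mem_ball_self hρ)]
  have h1 : HasFDerivAt f (fderiv ℂ f s) (s + (0 : ℂ) • v) := by
    simpa using (hf.differentiableAt (Metric.ball_mem_nhds s hr)).hasFDerivAt
  have h2 : HasDerivAt (fun ζ : ℂ => s + ζ • v) v 0 := by
    simpa using ((hasDerivAt_id (0 : ℂ)).smul_const v).const_add s
  exact (h1.comp_hasDerivAt (0 : ℂ) h2).deriv.symm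

/-- A bounded holomorphic function of several variables has a holomorphic derivative: each
directional derivative is a Cauchy integral along a complex line, which may be differentiated
under the integral sign. -/
theorem differentiableAt_fderiv_of_norm_le [FiniteDimensional ℂ E] {f : E → ℂ} {c : E} {r C : ℝ}
    (hr : 0 < r)
    (hf : DifferentiableOn ℂ f (Metric.ball c r)) (hC : ∀ s ∈ Metric.ball c r, ‖f s‖ ≤ C) :
    DifferentiableAt ℂ (fderiv ℂ f) c := by
  borelize E
  have : ProperSpace E := FiniteDimensional.proper ℂ E
  -- it is enough to differentiate along each direction, the space of linear forms being finite
  -- dimensional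
  suffices h : ∀ v, DifferentiableAt ℂ (fun s => fderiv ℂ f s v) c by
    let d := Module.finrank ℂ E
    have hd : d = Module.finrank ℂ (Fin d → ℂ) := (Module.finrank_fin_fun ℂ).symm
    let e₁ := ContinuousLinearEquiv.ofFinrankEq hd
    let e₂ := (e₁.arrowCongr (1 : ℂ ≃L[ℂ] ℂ)).trans (ContinuousLinearEquiv.piRing (Fin d))
    rw [← e₂.comp_differentiableAt_iff]
    exact differentiableAt_pi.2 fun i => h _
  intro v
  have hv1 : 0 < ‖v‖ + 1 := by positivity
  set ρ : ℝ := r / 4 / (‖v‖ + 1) with hρdef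
  have hρ : 0 < ρ := by positivity
  have hρv : ρ * ‖v‖ ≤ r / 4 := by
    rw [hρdef, div_mul_eq_mul_div, div_le_iff₀ hv1]
    nlinarith [norm_nonneg v]
  have hball : ∀ s ∈ Metric.ball c (r / 4), ∀ θ : ℝ,
      Metric.ball (s + circleMap 0 ρ θ • v) (r / 4) ⊆ Metric.ball c r := by
    intro s hs θ
    apply Metric.ball_subset_ball'
    have h1 : dist (s + circleMap 0 ρ θ • v) s ≤ r / 4 := by
      rw [dist_eq_norm, add_sub_cancel_left, norm_smul, norm_circleMap_zero, abs_of_pos hρ]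
      exact hρv
    have h2 := dist_triangle (s + circleMap 0 ρ θ • v) s c
    have h3 := Metric.mem_ball.1 hs
    linarith
  have hmem : ∀ s ∈ Metric.ball c (r / 4), ∀ θ : ℝ,
      s + circleMap 0 ρ θ • v ∈ Metric.ball c r := fun s hs θ =>
    hball s hs θ (Metric.mem_ball_self (by positivity))
  let k : ℝ → ℂ := fun θ => deriv (circleMap 0 ρ) θ * ((circleMap 0 ρ θ - 0) ^ 2)⁻¹
  have hk : Continuous k := by
    have h1 : Continuous (deriv (circleMap 0 ρ)) := by
      have : deriv (circleMap 0 ρ) = fun θ => circleMap 0 ρ θ * Complex.I := by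
        ext θ; simp
      rw [this]; fun_prop
    refine h1.mul (Continuous.inv₀ (by fun_prop) fun θ => ?_)
    simpa using hρ.ne'
  have hfc : ContinuousOn f (Metric.ball c r) := hf.continuousOn
  have hF : ∀ s ∈ Metric.ball c (r / 4),
      Continuous (fun θ => k θ * f (s + circleMap 0 ρ θ • v)) := by
    intro s hs
    refine hk.mul ?_
    exact hfc.comp_continuous (by fun_prop) (hmem s hs)
  have key : DifferentiableAt ℂ
      (fun s => ∫ θ in (0 : ℝ)..2 * Real.pi, k θ * f (s + circleMap 0 ρ θ • v)) c := by
    refine (intervalIntegral.hasFDerivAt_integral_of_dominated_of_fderiv_le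
      (F' := fun s θ => k θ • fderiv ℂ f (s + circleMap 0 ρ θ • v))
      (bound := fun θ => ‖k θ‖ * ((2 * C) / (r / 4)))
      (Metric.ball_mem_nhds c (show 0 < r / 4 by positivity)) ?_ ?_ ?_ ?_ ?_ ?_).differentiableAt
    · filter_upwards [Metric.ball_mem_nhds c (show 0 < r / 4 by positivity)] with s hs
      exact (hF s hs).aestronglyMeasurable
    · exact (hF c (Metric.mem_ball_self (by positivity))).intervalIntegrable _ _
    · refine AEStronglyMeasurable.smul hk.aestronglyMeasurable ?_
      have h1 : Measurable (fun θ : ℝ => fderiv ℂ f (c + circleMap 0 ρ θ • v)) :=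
        (measurable_fderiv ℂ f).comp
          (by fun_prop : Continuous fun θ : ℝ => c + circleMap 0 ρ θ • v).measurable
      exact h1.aestronglyMeasurable
    · refine Eventually.of_forall fun θ _ s hs => ?_
      rw [norm_smul]
      gcongr
      exact norm_fderiv_le_of_norm_le (by positivity) (hf.mono (hball s hs θ))
        (fun s' hs' => hC s' (hball s hs θ hs'))
    · exact (hk.norm.mul continuous_const).intervalIntegrable _ _
    · refine Eventually.of_forall fun θ _ s hs => ?_
      have h1 : HasFDerivAt f (fderiv ℂ f (s + circleMap 0 ρ θ • v)) (s + circleMap 0 ρ θ • v) :=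
        (hf.differentiableAt (Metric.isOpen_ball.mem_nhds (hmem s hs θ))).hasFDerivAt
      exact ((hasFDerivAt_comp_add_right (circleMap 0 ρ θ • v)).2 h1).const_mul (k θ)
  have heq : (fun s => fderiv ℂ f s v) =ᶠ[𝓝 c] fun s => (2 * Real.pi * Complex.I : ℂ)⁻¹ •
      ∫ θ in (0 : ℝ)..2 * Real.pi, k θ * f (s + circleMap 0 ρ θ • v) := by
    filter_upwards [Metric.ball_mem_nhds c (show 0 < r / 4 by positivity)] with s hs
    have hsub : Metric.ball s (r / 2) ⊆ Metric.ball c r := by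
      apply Metric.ball_subset_ball'
      have := Metric.mem_ball.1 hs
      linarith
    rw [fderiv_apply_eq_circleIntegral hρ (lt_of_le_of_lt hρv (by linarith : r / 4 < r / 2))
      (hf.mono hsub), circleIntegral]
    simp only [k, smul_eq_mul, mul_assoc]
  exact (key.const_smul (2 * Real.pi * Complex.I : ℂ)⁻¹).congr_of_eventuallyEq heq

/-- Cauchy estimates for a Hamiltonian: on the part over `G` of a compact subset of `D`, the
function `W(z, ·)` and its first two derivatives in `(s₁, s₂)` exist and are bounded, and the second
derivative is symmetric. -/
theorem IsHamiltonian.exists_bound {G : Set ℂ} {D : Set (ℂ × ℂ × ℂ)} {W : ℂ → ℂ → ℂ → ℂ}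
    (hW : IsHamiltonian G D W) {K : Set (ℂ × ℂ × ℂ)} (hK : IsCompact K) (hKD : K ⊆ D) :
    ∃ B : ℝ, 0 ≤ B ∧ ∀ z ∈ G, ∀ s : ℂ × ℂ, (z, s) ∈ K →
      ‖W z s.1 s.2‖ ≤ B ∧
      DifferentiableAt ℂ (fun s : ℂ × ℂ => W z s.1 s.2) s ∧
      ‖fderiv ℂ (fun s : ℂ × ℂ => W z s.1 s.2) s‖ ≤ B ∧
      DifferentiableAt ℂ (fderiv ℂ fun s : ℂ × ℂ => W z s.1 s.2) s ∧
      ‖fderiv ℂ (fderiv ℂ fun s : ℂ × ℂ => W z s.1 s.2) s‖ ≤ B ∧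
      ∀ v w, fderiv ℂ (fderiv ℂ fun s : ℂ × ℂ => W z s.1 s.2) s v w
        = fderiv ℂ (fderiv ℂ fun s : ℂ × ℂ => W z s.1 s.2) s w v := by
  obtain ⟨r, hr, hrD⟩ := hK.exists_cthickening_subset_open hW.isOpen_domain hKD
  obtain ⟨C, hC⟩ := hW.locally_bounded _ hrD hK.cthickening
  set C₁ : ℝ := (2 * C) / (r / 2)
  set C₂ : ℝ := (2 * C₁) / (r / 2)
  refine ⟨max 0 (max C (max C₁ C₂)), le_max_left _ _, fun z hz s hs => ?_⟩
  set f : ℂ × ℂ → ℂ := fun s => W z s.1 s.2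
  have hmem : ∀ s' ∈ Metric.ball s r, (z, s') ∈ Metric.cthickening r K := by
    intro s' hs'
    refine Metric.mem_cthickening_of_dist_le (z, s') (z, s) r K hs ?_
    rw [Prod.dist_eq, dist_self]
    exact max_le hr.le (Metric.mem_ball.1 hs').le
  have hCf : ∀ s' ∈ Metric.ball s r, ‖f s'‖ ≤ C := fun s' hs' => hC _ (hmem s' hs') hz
  have hf : DifferentiableOn ℂ f (Metric.ball s r) :=
    (hW.holomorphic z hz).mono fun s' hs' => hrD (hmem s' hs')
  have hsub : ∀ s' ∈ Metric.ball s (r / 2), Metric.ball s' (r / 2) ⊆ Metric.ball s r := by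
    intro s' hs'
    apply Metric.ball_subset_ball'
    have := Metric.mem_ball.1 hs'
    linarith
  have hr2 : 0 < r / 2 := by positivity
  have hs0 : s ∈ Metric.ball s (r / 2) := Metric.mem_ball_self hr2
  have hC₁ : ∀ s' ∈ Metric.ball s (r / 2), ‖fderiv ℂ f s'‖ ≤ C₁ := fun s' hs' =>
    norm_fderiv_le_of_norm_le hr2 (hf.mono (hsub s' hs'))
      fun t ht => hCf t (hsub s' hs' ht)
  have hdd : ∀ s' ∈ Metric.ball s (r / 2), DifferentiableAt ℂ (fderiv ℂ f) s' := fun s' hs' =>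
    differentiableAt_fderiv_of_norm_le hr2 (hf.mono (hsub s' hs'))
      fun t ht => hCf t (hsub s' hs' ht)
  refine ⟨?_, ?_, ?_, hdd s hs0, ?_, ?_⟩
  · exact (hCf s (Metric.mem_ball_self hr)).trans (by simp)
  · exact hf.differentiableAt (Metric.ball_mem_nhds s hr)
  · exact (hC₁ s hs0).trans (by simp)
  · refine (norm_fderiv_le_of_norm_le hr2
      (fun s' hs' => (hdd s' hs').differentiableWithinAt) hC₁).trans (by simp [C₂])
  · refine second_derivative_symmetric_of_eventually (𝕜 := ℂ) (f := f) ?_ (hdd s hs0).hasFDerivAt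
    filter_upwards [Metric.ball_mem_nhds s hr] with s' hs'
    exact (hf.differentiableAt (Metric.isOpen_ball.mem_nhds hs')).hasFDerivAt

end Holomorphic

/-! ### The Cauchy transform -/

section CauchyTransform

/-- Measurable bounded functions on the plane which vanish outside a bounded set. -/
structure IsBoundedCompact (f : ℂ → ℂ) : Prop where
  aestronglyMeasurable : AEStronglyMeasurable f volume
  exists_bound : ∃ M : ℝ, ∀ z, ‖f z‖ ≤ M
  exists_radius : ∃ R : ℝ, ∀ z, R < ‖z‖ → f z = 0

/-- The Cauchy transform `(1/π) ∬ f(z) / (w - z) dx dy`: the solution of `∂̄ u = f` which vanishes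
at infinity. -/
noncomputable def cauchyTransform (f : ℂ → ℂ) (w : ℂ) : ℂ :=
  (Real.pi : ℂ)⁻¹ * ∫ z, f z * (w - z)⁻¹

theorem locallyIntegrable_inv : LocallyIntegrable (fun w : ℂ => w⁻¹) := by
  refine locallyIntegrable_of_norm_le_rpow (C := 1) (α := 1) ?_ ?_ ?_ ?_
  · simp
  · simp
  · refine Eventually.of_forall fun w => ?_
    rw [Real.rpow_neg_one, norm_inv, one_mul]
  · exact measurable_inv.aestronglyMeasurable

theorem integrable_indicator_inv (R : ℝ) :
    Integrable ((Metric.closedBall (0 : ℂ) R).indicator fun w : ℂ => w⁻¹) :=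
  (integrable_indicator_iff Metric.isClosed_closedBall.measurableSet).2
    (locallyIntegrable_inv.integrableOn_isCompact (isCompact_closedBall _ _))

namespace IsBoundedCompact

variable {f g u : ℂ → ℂ}

theorem continuous_mul (hu : Continuous u) (hf : IsBoundedCompact f) :
    IsBoundedCompact fun z => u z * f z := by
  obtain ⟨M, hM⟩ := hf.exists_bound
  obtain ⟨R, hR⟩ := hf.exists_radius
  obtain ⟨B, hB⟩ := (isCompact_closedBall (0 : ℂ) R).exists_bound_of_continuousOn hu.continuousOn
  refine ⟨hu.aestronglyMeasurable.mul hf.aestronglyMeasurable, ⟨max 0 (B * M), fun z => ?_⟩,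
    ⟨R, fun z hz => by rw [hR z hz, mul_zero]⟩⟩
  by_cases hz : R < ‖z‖
  · simp [hR z hz]
  · have h1 := hB z (by simpa using hz)
    rw [norm_mul]
    exact (mul_le_mul h1 (hM z) (norm_nonneg _) ((norm_nonneg _).trans h1)).trans (le_max_right _ _)

theorem integrable_mul_inv (hf : IsBoundedCompact f) (w : ℂ) :
    Integrable fun z => f z * (w - z)⁻¹ := by
  obtain ⟨M, hM⟩ := hf.exists_bound
  obtain ⟨R, hR⟩ := hf.exists_radius
  refine (((integrable_indicator_inv (‖w‖ + R)).comp_sub_left w).bdd_mul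
    hf.aestronglyMeasurable (Eventually.of_forall hM)).congr (Eventually.of_forall fun z => ?_)
  by_cases hz : R < ‖z‖
  · simp [hR z hz]
  · have h1 : ‖w - z‖ ≤ ‖w‖ + R := (norm_sub_le _ _).trans (by linarith)
    simp only
    rw [indicator_of_mem (by simpa using h1)]

theorem integrable (hf : IsBoundedCompact f) : Integrable f := by
  obtain ⟨M, hM⟩ := hf.exists_bound
  obtain ⟨R, hR⟩ := hf.exists_radius
  have h1 : Integrable ((Metric.closedBall (0 : ℂ) R).indicator fun _ => (1 : ℂ)) :=
    (integrable_indicator_iff Metric.isClosed_closedBall.measurableSet).2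
      (integrableOn_const (isCompact_closedBall _ _).measure_lt_top.ne)
  refine (h1.bdd_mul hf.aestronglyMeasurable (Eventually.of_forall hM)).congr
    (Eventually.of_forall fun z => ?_)
  by_cases hz : R < ‖z‖
  · simp [hR z hz]
  · simp only
    rw [indicator_of_mem (by simpa using hz), mul_one]

/-- The double integrals of the Cauchy kernel against `F` and `g` converge absolutely: on the
supports the kernel may be cut off to an integrable function, and what remains is a convolution
multiplied by a bounded function. -/
theorem integrable_prod_kernel {F : ℂ → ℂ} (hF : Integrable F)
    (hFs : ∃ R : ℝ, ∀ z, R < ‖z‖ → F z = 0) (hg : IsBoundedCompact g) :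
    Integrable (fun q : ℂ × ℂ => F q.1 * (g q.2 * (q.1 - q.2)⁻¹)) (volume.prod volume) := by
  obtain ⟨M, hM⟩ := hg.exists_bound
  obtain ⟨R, hR⟩ := hg.exists_radius
  obtain ⟨R', hR'⟩ := hFs
  have h1 := (hF.convolution_integrand (ContinuousLinearMap.mul ℂ ℂ)
    (integrable_indicator_inv (R' + R))).swap
  have h2 : AEStronglyMeasurable (fun q : ℂ × ℂ => -g q.2) (volume.prod volume) :=
    hg.aestronglyMeasurable.comp_snd.neg
  refine (h1.bdd_mul (c := M) h2 (Eventually.of_forall fun q => by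
    rw [norm_neg]; exact hM q.2)).congr (Eventually.of_forall fun q => ?_)
  simp only [Function.comp, Prod.fst_swap, Prod.snd_swap, ContinuousLinearMap.mul_apply']
  by_cases hz : R < ‖q.2‖
  · simp [hR _ hz]
  by_cases hz' : R' < ‖q.1‖
  · simp [hR' _ hz']
  have h3 : ‖q.2 - q.1‖ ≤ R' + R := (norm_sub_le _ _).trans (by linarith)
  rw [indicator_of_mem (by simpa using h3), ← neg_sub q.1 q.2, inv_neg]
  ring

/-- The Cauchy transform is antisymmetric, as its kernel is. -/
theorem integral_mul_cauchyTransform (hf : IsBoundedCompact f) (hg : IsBoundedCompact g) :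
    ∫ z, f z * cauchyTransform g z = -∫ z, g z * cauchyTransform f z := by
  have h1 := integrable_prod_kernel hf.integrable hf.exists_radius hg
  have h2 : ∀ (f g : ℂ → ℂ), ∫ z, f z * cauchyTransform g z
      = (Real.pi : ℂ)⁻¹ * ∫ z, ∫ w, f z * (g w * (z - w)⁻¹) := by
    intro f g
    rw [← integral_const_mul]
    refine integral_congr_ae (Eventually.of_forall fun z => ?_)
    simp only [cauchyTransform]
    rw [integral_const_mul]
    ring
  rw [h2, h2, integral_integral_swap h1, ← mul_neg, ← integral_neg]
  congr 1
  refine integral_congr_ae (Eventually.of_forall fun z => ?_)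
  simp only
  rw [← integral_neg]
  refine integral_congr_ae (Eventually.of_forall fun w => ?_)
  simp only
  rw [← neg_sub z w, inv_neg]
  ring

/-- The product rule `∂̄ (u v) = u ∂̄ v + v ∂̄ u`, in integral form. It comes from the identity
`1 / ((w - z) (w - z')) = 1 / ((w - z) (z - z')) + 1 / ((w - z') (z' - z))`. -/
theorem cauchyTransform_mul_cauchyTransform (hf : IsBoundedCompact f) (hg : IsBoundedCompact g)
    (w : ℂ) :
    cauchyTransform f w * cauchyTransform g w
      = cauchyTransform (fun z => cauchyTransform g z * f z) w
        + cauchyTransform (fun z => cauchyTransform f z * g z) w := by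
  let F : (ℂ → ℂ) → ℂ → ℂ := fun f z => f z * (w - z)⁻¹
  have hFs : ∀ f, IsBoundedCompact f → ∃ R : ℝ, ∀ z, R < ‖z‖ → F f z = 0 := fun f hf => by
    obtain ⟨R, hR⟩ := hf.exists_radius
    exact ⟨R, fun z hz => by simp [F, hR z hz]⟩
  let A : ℂ × ℂ → ℂ := fun q => F f q.1 * (g q.2 * (q.1 - q.2)⁻¹)
  let B : ℂ × ℂ → ℂ := fun q => F g q.1 * (f q.2 * (q.1 - q.2)⁻¹)
  have hA : Integrable A (volume.prod volume) :=
    integrable_prod_kernel (hf.integrable_mul_inv w) (hFs f hf) hg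
  have hB : Integrable B (volume.prod volume) :=
    integrable_prod_kernel (hg.integrable_mul_inv w) (hFs g hg) hf
  have h1 : ∀ (f g : ℂ → ℂ), cauchyTransform (fun z => cauchyTransform g z * f z) w
      = (Real.pi : ℂ)⁻¹ * ((Real.pi : ℂ)⁻¹ * ∫ z, ∫ z', F f z * (g z' * (z - z')⁻¹)) := by
    intro f g
    rw [cauchyTransform]
    congr 1
    rw [← integral_const_mul]
    refine integral_congr_ae (Eventually.of_forall fun z => ?_)
    simp only [cauchyTransform, F]
    rw [integral_const_mul]
    ring
  have h2 : ∫ q, A q ∂(volume.prod volume) + ∫ q, B q ∂(volume.prod volume)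
      = (∫ z, F f z) * ∫ z, F g z := by
    have hne : ∀ᵐ z : ℂ, z ≠ w := by simp [ae_iff, measure_singleton]
    have hd : ∀ᵐ q : ℂ × ℂ ∂(volume.prod volume), q.1 ≠ q.2 ∧ q.1 ≠ w ∧ q.2 ≠ w := by
      rw [Measure.ae_prod_iff_ae_ae]
      · filter_upwards [hne] with z hz
        have hne' : ∀ᵐ z' : ℂ, z' ≠ z := by simp [ae_iff, measure_singleton]
        filter_upwards [hne, hne'] with z' hz' hzz'
        exact ⟨hzz'.symm, hz, hz'⟩
      · exact ((measurableSet_eq_fun measurable_fst measurable_snd).compl.inter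
          ((measurableSet_eq_fun measurable_fst measurable_const).compl.inter
            (measurableSet_eq_fun measurable_snd measurable_const).compl))
    rw [← integral_prod_swap B, ← integral_prod_mul]
    refine (integral_add hA hB.swap).symm.trans (integral_congr_ae (hd.mono fun q hq => ?_))
    obtain ⟨h, h', h''⟩ := hq
    have e1 : w - q.1 ≠ 0 := sub_ne_zero.2 h'.symm
    have e2 : w - q.2 ≠ 0 := sub_ne_zero.2 h''.symm
    have e3 : q.1 - q.2 ≠ 0 := sub_ne_zero.2 h
    simp only [A, B, F, Function.comp, Prod.fst_swap, Prod.snd_swap]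
    rw [← neg_sub q.1 q.2, inv_neg]
    field_simp
    ring
  rw [h1, h1, ← integral_prod A hA, ← integral_prod B hB, ← mul_add, ← mul_add, h2]
  simp only [cauchyTransform, F]
  ring

theorem integrable_inv_sub_mul_inv (hf : IsBoundedCompact f) {p w : ℂ} (hw : w ≠ p) :
    Integrable fun z => ((z - p)⁻¹ * f z) * (w - z)⁻¹ := by
  refine (((hf.integrable_mul_inv w).sub (hf.integrable_mul_inv p)).const_mul (w - p)⁻¹).congr ?_
  have hne : ∀ a : ℂ, ∀ᵐ z : ℂ, z ≠ a := fun a => by simp [ae_iff, measure_singleton]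
  filter_upwards [hne p, hne w] with z hzp hzw
  have e1 : w - z ≠ 0 := sub_ne_zero.2 hzw.symm
  have e2 : p - z ≠ 0 := sub_ne_zero.2 hzp.symm
  have e3 : z - p ≠ 0 := sub_ne_zero.2 hzp
  have e4 : w - p ≠ 0 := sub_ne_zero.2 hw
  simp only [Pi.sub_apply]
  field_simp
  ring

/-- Multiplication by `1 / (z - p)` commutes with the Cauchy transform up to the value at `p`. -/
theorem cauchyTransform_inv_sub_mul (hf : IsBoundedCompact f) {p w : ℂ} (hw : w ≠ p) :
    cauchyTransform (fun z => (z - p)⁻¹ * f z) w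
      = (w - p)⁻¹ * (cauchyTransform f w - cauchyTransform f p) := by
  have hne : ∀ a : ℂ, ∀ᵐ z : ℂ, z ≠ a := fun a => by simp [ae_iff, measure_singleton]
  have h : ∫ z, ((z - p)⁻¹ * f z) * (w - z)⁻¹
      = ∫ z, (w - p)⁻¹ * (f z * (w - z)⁻¹ - f z * (p - z)⁻¹) := by
    refine integral_congr_ae ?_
    filter_upwards [hne p, hne w] with z hzp hzw
    have e1 : w - z ≠ 0 := sub_ne_zero.2 hzw.symm
    have e2 : p - z ≠ 0 := sub_ne_zero.2 hzp.symm
    have e3 : z - p ≠ 0 := sub_ne_zero.2 hzp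
    have e4 : w - p ≠ 0 := sub_ne_zero.2 hw
    field_simp
    ring
  rw [cauchyTransform, h, integral_const_mul,
    integral_sub (hf.integrable_mul_inv w) (hf.integrable_mul_inv p)]
  simp only [cauchyTransform]
  ring

end IsBoundedCompact

end CauchyTransform

/-! ### Solutions of the weak ∂̄-equation -/

section Representation

/-- A smooth function on the line which increases from `0` to `1` on the interval `[1, 2]`. -/
noncomputable def smoothStep (t : ℝ) : ℝ := Real.smoothTransition (t - 1)

theorem contDiff_smoothStep : ContDiff ℝ ∞ smoothStep :=
  Real.smoothTransition.contDiff.comp (contDiff_id.sub contDiff_const)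

theorem smoothStep_of_le {t : ℝ} (ht : t ≤ 1) : smoothStep t = 0 :=
  Real.smoothTransition.zero_of_nonpos (by linarith)

theorem smoothStep_of_ge {t : ℝ} (ht : 2 ≤ t) : smoothStep t = 1 :=
  Real.smoothTransition.one_of_one_le (by linarith)

theorem hasDerivAt_smoothStep (t : ℝ) : HasDerivAt smoothStep (deriv smoothStep t) t :=
  (contDiff_smoothStep.differentiable (by simp) t).hasDerivAt

theorem continuous_deriv_smoothStep : Continuous (deriv smoothStep) :=
  contDiff_smoothStep.continuous_deriv (by simp)

theorem deriv_smoothStep_of_gt {t : ℝ} (ht : 2 < t) : deriv smoothStep t = 0 := by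
  have : smoothStep =ᶠ[𝓝 t] fun _ => 1 := by
    filter_upwards [lt_mem_nhds ht] with s hs using smoothStep_of_ge hs.le
  rw [this.deriv_eq, deriv_const]

theorem deriv_smoothStep_of_lt {t : ℝ} (ht : t < 1) : deriv smoothStep t = 0 := by
  have : smoothStep =ᶠ[𝓝 t] fun _ => 0 := by
    filter_upwards [gt_mem_nhds ht] with s hs using smoothStep_of_le hs.le
  rw [this.deriv_eq, deriv_const]

theorem hasCompactSupport_deriv_smoothStep (w : ℂ) {a : ℝ} (ha : 0 < a) :
    HasCompactSupport fun z : ℂ => ((deriv smoothStep (a * ‖z - w‖ ^ 2) : ℝ) : ℂ) := by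
  refine HasCompactSupport.intro (isCompact_closedBall w (2 / a + 1)) fun z hz => ?_
  rw [Metric.mem_closedBall, not_le, dist_eq_norm] at hz
  have h1 : 0 < 2 / a := by positivity
  have h2 : a * (2 / a) = 2 := by field_simp
  have h3 : 2 / a < ‖z - w‖ ^ 2 := by nlinarith
  rw [deriv_smoothStep_of_gt (by rw [← h2]; gcongr), Complex.ofReal_zero]

theorem integral_deriv_smoothStep_norm_sq :
    ∫ v : ℂ, ((deriv smoothStep (‖v‖ ^ 2) : ℝ) : ℂ) = Real.pi := by
  have h1 : ∀ y : ℝ, HasDerivAt (fun y => smoothStep (y ^ 2) / 2)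
      (y * deriv smoothStep (y ^ 2)) y := by
    intro y
    have := ((hasDerivAt_smoothStep (y ^ 2)).comp y (hasDerivAt_pow 2 y)).div_const 2
    exact this.congr_deriv (by push_cast; ring)
  have h2 : Tendsto (fun y : ℝ => smoothStep (y ^ 2) / 2) atTop (𝓝 (1 / 2)) := by
    refine tendsto_const_nhds.congr' ?_
    filter_upwards [eventually_ge_atTop 2] with y hy
    rw [smoothStep_of_ge (by nlinarith)]
  have h3 : Integrable fun y : ℝ => y * deriv smoothStep (y ^ 2) := by
    refine Continuous.integrable_of_hasCompactSupport
      (continuous_id.mul (continuous_deriv_smoothStep.comp (by fun_prop))) ?_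
    refine HasCompactSupport.intro (isCompact_closedBall (0 : ℝ) 2) fun y hy => ?_
    rw [Metric.mem_closedBall, not_le, dist_zero_right, Real.norm_eq_abs] at hy
    rw [deriv_smoothStep_of_gt (by rw [← sq_abs]; nlinarith), mul_zero]
  have h4 := integral_Ioi_of_hasDerivAt_of_tendsto' (a := 0) (fun y _ => h1 y) h3.integrableOn h2
  rw [integral_complex_ofReal,
    integral_fun_norm_addHaar volume (fun y : ℝ => deriv smoothStep (y ^ 2))]
  have h5 : volume.real (Metric.ball (0 : ℂ) 1) = Real.pi := by
    simp [Measure.real, Complex.volume_ball]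
  rw [Complex.finrank_real_complex, h5]
  simp only [Nat.add_one_sub_one, pow_one, smul_eq_mul]
  rw [h4, smoothStep_of_le (by norm_num)]
  push_cast
  simp
  ring

/-- Test functions adapted to the Cauchy kernel: for `φ = k(|z - w|²) / (z - w)`, the derivative
`∂̄ φ` is the radial function `k'(|z - w|²)`. -/
theorem testFunction_properties (w : ℂ) {k : ℝ → ℝ} (hk : ContDiff ℝ ∞ k) {δ R : ℝ} (hδ : 0 < δ)
    (hk0 : ∀ t, t < δ → k t = 0) (hkR : ∀ t, R < t → k t = 0) :
    ContDiff ℝ ∞ (fun z : ℂ => (k (‖z - w‖ ^ 2) : ℂ) * (z - w)⁻¹) ∧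
    HasCompactSupport (fun z : ℂ => (k (‖z - w‖ ^ 2) : ℂ) * (z - w)⁻¹) ∧
    ∀ z, dbar (fun z : ℂ => (k (‖z - w‖ ^ 2) : ℂ) * (z - w)⁻¹) z
      = deriv k (‖z - w‖ ^ 2) := by
  set φ : ℂ → ℂ := fun z : ℂ => (k (‖z - w‖ ^ 2) : ℂ) * (z - w)⁻¹
  have hw : φ =ᶠ[𝓝 w] fun _ => 0 := by
    have h1 : Tendsto (fun z : ℂ => ‖z - w‖ ^ 2) (𝓝 w) (𝓝 0) := by
      have : Continuous fun z : ℂ => ‖z - w‖ ^ 2 := by fun_prop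
      simpa using this.tendsto w
    filter_upwards [h1.eventually (gt_mem_nhds hδ)] with z hz
    simp [φ, hk0 _ hz]
  refine ⟨contDiff_iff_contDiffAt.2 fun z => ?_, ?_, fun z => ?_⟩
  · rcases eq_or_ne z w with rfl | hz
    · exact contDiffAt_const.congr_of_eventuallyEq hw
    · have h1 : ContDiffAt ℝ ∞ (fun z : ℂ => (k (‖z - w‖ ^ 2) : ℂ)) z :=
        (Complex.ofRealCLM.contDiff.comp
          (hk.comp ((contDiff_id.sub contDiff_const).norm_sq ℝ))).contDiffAt
      exact h1.mul ((contDiffAt_id.sub contDiffAt_const).inv (sub_ne_zero.2 hz))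
  · refine HasCompactSupport.intro (isCompact_closedBall w (|R| + 1)) fun z hz => ?_
    rw [Metric.mem_closedBall, not_le, dist_eq_norm] at hz
    have h1 : R < ‖z - w‖ ^ 2 := by nlinarith [le_abs_self R, abs_nonneg R]
    simp [φ, hkR _ h1]
  · rcases eq_or_ne z w with rfl | hz
    · have h1 : k =ᶠ[𝓝 (‖z - z‖ ^ 2)] fun _ => 0 := by
        filter_upwards [gt_mem_nhds (by simpa using hδ : ‖z - z‖ ^ 2 < δ)] with t ht
          using hk0 t ht
      rw [dbar, hw.fderiv_eq, h1.deriv_eq]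
      simp
    · have hz' : z - w ≠ 0 := sub_ne_zero.2 hz
      have h0 : HasFDerivAt (fun z : ℂ => z - w) (ContinuousLinearMap.id ℝ ℂ) z :=
        (hasFDerivAt_id z).sub_const w
      have h1 := (hk.differentiable (by simp) (‖z - w‖ ^ 2)).hasDerivAt.comp_hasFDerivAt z
        h0.norm_sq
      have h2 := Complex.ofRealCLM.hasFDerivAt.comp z h1
      have h3 : HasFDerivAt (fun z : ℂ => (z - w)⁻¹)
          ((ContinuousLinearMap.toSpanSingleton ℂ (-1 / (z - w) ^ 2)).restrictScalars ℝ) z :=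
        (((hasDerivAt_id z).sub_const w).inv hz').hasFDerivAt.restrictScalars ℝ
      have h4 := (h2.mul h3).fderiv
      have h5 : fderiv ℝ φ z = _ := h4
      rw [dbar, h5]
      have hre : ((z - w).re : ℂ) + (z - w).im * Complex.I = z - w := Complex.re_add_im _
      have hi1 : inner ℝ (z - w) (1 : ℂ) = (z - w).re := by simp [Complex.inner]
      have hi2 : inner ℝ (z - w) Complex.I = (z - w).im := by
        simp [Complex.inner]
        ring
      simp only [add_apply, smul_apply,
        ContinuousLinearMap.coe_restrictScalars', ContinuousLinearMap.toSpanSingleton_apply,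
        ContinuousLinearMap.comp_apply, ContinuousLinearMap.id_apply, innerSL_apply_apply,
        Complex.ofRealCLM_apply, smul_eq_mul, nsmul_eq_mul, hi1, hi2, Function.comp]
      push_cast
      linear_combination (z - w)⁻¹ * (deriv k (‖z - w‖ ^ 2) : ℝ) * hre
        + ((deriv k (‖z - w‖ ^ 2) : ℝ) : ℂ) * inv_mul_cancel₀ hz'
        - (k (‖z - w‖ ^ 2) : ℂ) * ((z - w) ^ 2)⁻¹ / 2 * Complex.I_sq

theorem integral_mul_deriv_smoothStep (u : ℂ → ℂ) (w : ℂ) {a : ℝ} (ha : 0 < a) :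
    ∫ z, u z * (a ^ 2 * deriv smoothStep (a ^ 2 * ‖z - w‖ ^ 2) : ℝ)
      = ∫ v, u (w + a⁻¹ • v) * deriv smoothStep (‖v‖ ^ 2) := by
  rw [← integral_add_left_eq_self _ w]
  have h := Measure.integral_comp_smul (volume : Measure ℂ)
    (fun v : ℂ => u (w + a⁻¹ • v) * deriv smoothStep (‖v‖ ^ 2)) a
  rw [Complex.finrank_real_complex, abs_of_pos (by positivity)] at h
  have h2 : ∫ v, u (w + a⁻¹ • v) * deriv smoothStep (‖v‖ ^ 2)
      = (a ^ 2) • ∫ x : ℂ, u (w + a⁻¹ • a • x) * deriv smoothStep (‖a • x‖ ^ 2) := by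
    rw [h, smul_smul, mul_inv_cancel₀ (by positivity), one_smul]
  rw [h2, ← integral_smul]
  refine integral_congr_ae (Eventually.of_forall fun z => ?_)
  have h3 : ‖a • z‖ ^ 2 = a ^ 2 * ‖z‖ ^ 2 := by
    rw [norm_smul, Real.norm_eq_abs, abs_of_pos ha, mul_pow]
  simp only [add_sub_cancel_left, inv_smul_smul₀ ha.ne', h3]
  rw [Complex.real_smul]
  push_cast
  ring

theorem tendsto_integral_smoothStep {u : ℂ → ℂ} (hu : Continuous u) {B : ℝ} (hB : ∀ z, ‖u z‖ ≤ B)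
    (w : ℂ) {a : ℕ → ℝ} {l : ℂ}
    (h : ∀ v : ℂ, v ≠ 0 → Tendsto (fun n => u (w + a n • v)) atTop (𝓝 l)) :
    Tendsto (fun n => ∫ v, u (w + a n • v) * deriv smoothStep (‖v‖ ^ 2)) atTop
      (𝓝 (l * Real.pi)) := by
  have hc : Continuous fun v : ℂ => ((deriv smoothStep (‖v‖ ^ 2) : ℝ) : ℂ) :=
    Complex.continuous_ofReal.comp (continuous_deriv_smoothStep.comp (by fun_prop))
  have hi : Integrable fun v : ℂ => ((deriv smoothStep (‖v‖ ^ 2) : ℝ) : ℂ) := by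
    refine hc.integrable_of_hasCompactSupport ?_
    simpa using hasCompactSupport_deriv_smoothStep 0 one_pos
  rw [← integral_deriv_smoothStep_norm_sq, ← integral_const_mul]
  refine tendsto_integral_of_dominated_convergence
    (fun v => B * ‖((deriv smoothStep (‖v‖ ^ 2) : ℝ) : ℂ)‖) (fun n => ?_) (hi.norm.const_mul B)
    (fun n => Eventually.of_forall fun v => ?_) (Eventually.of_forall fun v => ?_)
  · exact ((hu.comp (by fun_prop)).mul hc).aestronglyMeasurable
  · rw [norm_mul]
    gcongr
    exact hB _
  · rcases eq_or_ne v 0 with rfl | hv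
    · rw [deriv_smoothStep_of_lt (by norm_num)]
      simp
    · exact (h v hv).mul_const _

/-- A continuous function `u` which vanishes at infinity is the Cauchy transform of `∂̄ u`. The
equation is tested on `φ = (χ(a² |z - w|²) - χ(|z - w|² / a²)) / (z - w)`, with `χ` a smooth step
and `a → ∞`: one half of `∂̄ φ` concentrates at `w`, the other one goes to infinity. -/
theorem HasWeakDbar.eq_cauchyTransform {u g : ℂ → ℂ} (h : HasWeakDbar u g) (hu : Continuous u)
    (h0 : Tendsto u (cocompact ℂ) (𝓝 0)) (hg : IsBoundedCompact g) (w : ℂ) :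
    u w = cauchyTransform g w := by
  obtain ⟨B, hB⟩ : ∃ B : ℝ, ∀ z, ‖u z‖ ≤ B := by
    let U : ZeroAtInftyContinuousMap ℂ ℂ := ⟨⟨u, hu⟩, h0⟩
    exact ⟨‖U.toBCF‖, fun z => U.toBCF.norm_coe_le_norm z⟩
  let a : ℕ → ℝ := fun n => n + 1
  have ha : ∀ n, 0 < a n := fun n => by positivity
  have ha1 : ∀ n, 1 ≤ a n := fun n => by simp [a]
  have haT : Tendsto a atTop atTop :=
    tendsto_atTop_add_const_right _ _ tendsto_natCast_atTop_atTop
  let k : ℕ → ℝ → ℝ := fun n t => smoothStep (a n ^ 2 * t) - smoothStep ((a n)⁻¹ ^ 2 * t)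
  have hkd : ∀ n t, deriv (k n) t = a n ^ 2 * deriv smoothStep (a n ^ 2 * t)
      - (a n)⁻¹ ^ 2 * deriv smoothStep ((a n)⁻¹ ^ 2 * t) := by
    intro n t
    have h1 : ∀ c : ℝ, HasDerivAt (fun t => smoothStep (c * t))
        (c * deriv smoothStep (c * t)) t := fun c => by
      have := (hasDerivAt_smoothStep (c * t)).comp t ((hasDerivAt_id t).const_mul c)
      exact this.congr_deriv (by ring)
    exact ((h1 _).sub (h1 _)).deriv
  have hks : ∀ n, ContDiff ℝ ∞ (k n) := fun n =>
    (contDiff_smoothStep.comp (contDiff_const.mul contDiff_id)).sub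
      (contDiff_smoothStep.comp (contDiff_const.mul contDiff_id))
  have hk0 : ∀ n t, t < (a n ^ 2)⁻¹ → k n t = 0 := by
    intro n t ht
    have h1 : 1 ≤ a n ^ 2 := one_le_pow₀ (ha1 n)
    have h2 : a n ^ 2 * t ≤ 1 := by
      rw [← mul_inv_cancel₀ (by positivity : a n ^ 2 ≠ 0)]
      gcongr
    have h3 : (a n)⁻¹ ^ 2 * t ≤ 1 := by
      rcases le_total t 0 with h | h
      · nlinarith [sq_nonneg (a n)⁻¹]
      · have : (a n)⁻¹ ^ 2 ≤ 1 := pow_le_one₀ (by positivity) (inv_le_one_of_one_le₀ (ha1 n))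
        nlinarith
    simp only [k]
    rw [smoothStep_of_le h2, smoothStep_of_le h3, sub_zero]
  have hkR : ∀ n t, 2 * a n ^ 2 < t → k n t = 0 := by
    intro n t ht
    have h1 : 1 ≤ a n ^ 2 := one_le_pow₀ (ha1 n)
    have h2 : 2 ≤ a n ^ 2 * t := by nlinarith
    have h3 : 2 ≤ (a n)⁻¹ ^ 2 * t := by
      rw [inv_pow, inv_mul_eq_div, le_div_iff₀ (by positivity)]
      exact ht.le
    simp only [k]
    rw [smoothStep_of_ge h2, smoothStep_of_ge h3, sub_self]
  have hint : ∀ b : ℝ, 0 < b →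
      Integrable fun z => u z * (b ^ 2 * deriv smoothStep (b ^ 2 * ‖z - w‖ ^ 2) : ℝ) := by
    intro b hb
    have hc : Continuous fun z : ℂ => ((deriv smoothStep (b ^ 2 * ‖z - w‖ ^ 2) : ℝ) : ℂ) :=
      Complex.continuous_ofReal.comp (continuous_deriv_smoothStep.comp (by fun_prop))
    have := ((hu.mul hc).integrable_of_hasCompactSupport (μ := volume)
      ((hasCompactSupport_deriv_smoothStep w (by positivity : 0 < b ^ 2)).mul_left)).const_mul
        ((b ^ 2 : ℝ) : ℂ)
    refine this.congr (Eventually.of_forall fun z => ?_)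
    simp only [Pi.mul_apply]
    push_cast
    ring
  have hL : ∀ n, (∫ v, u (w + (a n)⁻¹ • v) * deriv smoothStep (‖v‖ ^ 2))
      - (∫ v, u (w + a n • v) * deriv smoothStep (‖v‖ ^ 2))
      = - ∫ z, g z * ((k n (‖z - w‖ ^ 2) : ℂ) * (z - w)⁻¹) := by
    intro n
    obtain ⟨h1, h2, h3⟩ := testFunction_properties w (hks n) (inv_pos.2 (pow_pos (ha n) 2))
      (hk0 n) (hkR n)
    rw [← h.2.2 _ h1 h2]
    have h4 := integral_mul_deriv_smoothStep u w (ha n)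
    have h5 := integral_mul_deriv_smoothStep u w (inv_pos.2 (ha n))
    rw [inv_inv] at h5
    rw [← h4, ← h5, ← integral_sub (hint _ (ha n)) (hint _ (inv_pos.2 (ha n)))]
    refine integral_congr_ae (Eventually.of_forall fun z => ?_)
    simp only
    rw [h3, hkd, Complex.ofReal_sub]
    ring
  have hl1 : Tendsto (fun n => ∫ v, u (w + (a n)⁻¹ • v) * deriv smoothStep (‖v‖ ^ 2)) atTop
      (𝓝 (u w * Real.pi)) := by
    refine tendsto_integral_smoothStep hu hB w fun v _ => ?_
    have h1 : Tendsto (fun n => w + (a n)⁻¹ • v) atTop (𝓝 (w + (0 : ℝ) • v)) :=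
      ((tendsto_inv_atTop_zero.comp haT).smul_const v).const_add w
    rw [zero_smul, add_zero] at h1
    exact (hu.tendsto w).comp h1
  have hl2 : Tendsto (fun n => ∫ v, u (w + a n • v) * deriv smoothStep (‖v‖ ^ 2)) atTop
      (𝓝 (0 * Real.pi)) := by
    refine tendsto_integral_smoothStep hu hB w fun v hv => h0.comp ?_
    rw [← Metric.cobounded_eq_cocompact, ← tendsto_norm_atTop_iff_cobounded]
    have h1 : Tendsto (fun n => a n * ‖v‖ - ‖w‖) atTop atTop :=
      tendsto_atTop_add_const_right _ _ (haT.atTop_mul_const (norm_pos_iff.2 hv))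
    refine tendsto_atTop_mono (fun n => ?_) h1
    have h2 : ‖a n • v‖ = a n * ‖v‖ := by
      rw [norm_smul, Real.norm_eq_abs, abs_of_pos (ha n)]
    rw [← h2]
    have h3 := norm_sub_le (w + a n • v) w
    rw [add_sub_cancel_left] at h3
    linarith
  have hr : Tendsto (fun n => ∫ z, g z * ((k n (‖z - w‖ ^ 2) : ℂ) * (z - w)⁻¹)) atTop
      (𝓝 (∫ z, g z * (z - w)⁻¹)) := by
    have hgi : Integrable fun z => g z * (z - w)⁻¹ := by
      refine (hg.integrable_mul_inv w).neg.congr (Eventually.of_forall fun z => ?_)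
      simp only [Pi.neg_apply]
      rw [← neg_sub z w, inv_neg]
      ring
    refine tendsto_integral_of_dominated_convergence (fun z => ‖g z * (z - w)⁻¹‖) (fun n => ?_)
      hgi.norm (fun n => Eventually.of_forall fun z => ?_) (Eventually.of_forall fun z => ?_)
    · refine hg.aestronglyMeasurable.mul (AEStronglyMeasurable.mul ?_ ?_)
      · exact (Complex.continuous_ofReal.comp
          ((hks n).continuous.comp (by fun_prop))).aestronglyMeasurable
      · exact (measurable_id.sub_const w).inv.aestronglyMeasurable
    · have h1 : ‖(k n (‖z - w‖ ^ 2) : ℂ)‖ ≤ 1 := by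
        rw [Complex.norm_real, Real.norm_eq_abs, abs_le]
        have e1 := Real.smoothTransition.nonneg (a n ^ 2 * ‖z - w‖ ^ 2 - 1)
        have e2 := Real.smoothTransition.le_one (a n ^ 2 * ‖z - w‖ ^ 2 - 1)
        have e3 := Real.smoothTransition.nonneg ((a n)⁻¹ ^ 2 * ‖z - w‖ ^ 2 - 1)
        have e4 := Real.smoothTransition.le_one ((a n)⁻¹ ^ 2 * ‖z - w‖ ^ 2 - 1)
        simp only [k, smoothStep]
        constructor <;> linarith
      rw [norm_mul, norm_mul, norm_mul]
      gcongr
      exact mul_le_of_le_one_left (norm_nonneg _) h1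
    · rcases eq_or_ne z w with rfl | hz
      · simp
      · have hpos : 0 < ‖z - w‖ ^ 2 := by
          have := norm_pos_iff.2 (sub_ne_zero.2 hz)
          positivity
        have ha2 : Tendsto (fun n => a n ^ 2) atTop atTop :=
          (tendsto_pow_atTop two_ne_zero).comp haT
        refine tendsto_const_nhds.congr' ?_
        have e1 := (ha2.atTop_mul_const hpos).eventually (eventually_ge_atTop 2)
        have e2 := ha2.eventually (eventually_ge_atTop (‖z - w‖ ^ 2))
        filter_upwards [e1, e2] with n h1 h2
        have h3 : (a n)⁻¹ ^ 2 * ‖z - w‖ ^ 2 ≤ 1 := by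
          rw [inv_pow, inv_mul_eq_div]
          exact div_le_one_of_le₀ h2 (by positivity)
        simp only [k]
        rw [smoothStep_of_ge h1, smoothStep_of_le h3, sub_zero, Complex.ofReal_one, one_mul]
  have heq := tendsto_nhds_unique (hl1.sub hl2) (hr.neg.congr fun n => (hL n).symm)
  rw [zero_mul, sub_zero] at heq
  have hpi : (Real.pi : ℂ) ≠ 0 := by exact_mod_cast Real.pi_ne_zero
  rw [cauchyTransform, eq_inv_mul_iff_mul_eq₀ hpi, mul_comm, heq, ← integral_neg]
  refine integral_congr_ae (Eventually.of_forall fun z => ?_)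
  simp only
  rw [← neg_sub z w, inv_neg]
  ring

/-- The distributional derivative is unique up to equality almost everywhere. -/
theorem HasWeakDbar.weakDbar_ae_eq {u g : ℂ → ℂ} (h : HasWeakDbar u g) :
    weakDbar u =ᵐ[volume] g := by
  have hex : ∃ g, HasWeakDbar u g := ⟨g, h⟩
  have h1 : HasWeakDbar u (weakDbar u) := by
    rw [weakDbar, dif_pos hex]
    exact hex.choose_spec
  refine ae_eq_of_integral_contDiff_smul_eq h1.2.1 h.2.1 fun φ hφ hφs => ?_
  have h2 : ContDiff ℝ ∞ fun z => (φ z : ℂ) := Complex.ofRealCLM.contDiff.comp hφ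
  have h3 : HasCompactSupport fun z => (φ z : ℂ) := hφs.comp_left Complex.ofReal_zero
  have h4 := (h1.2.2 _ h2 h3).symm.trans (h.2.2 _ h2 h3)
  simp only [Complex.real_smul]
  simpa only [mul_comm, neg_inj] using h4

end Representation

/-! ### Dependence of the solution on the parameters -/

section Sources

/-- The component `G.indicator (DW(z, s(z)) e)` of the gradient of `W` along a field `s`. The right
hand sides of the `∂̄`-problem are those for `e = (0, 1)` and `e = (-1, 0)`. -/
noncomputable def source (G : Set ℂ) (W : ℂ → ℂ → ℂ → ℂ) (s : ℂ → ℂ × ℂ) (e : ℂ × ℂ) : ℂ → ℂ :=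
  G.indicator fun z => fderiv ℂ (fun σ : ℂ × ℂ => W z σ.1 σ.2) (s z) e

/-- The variation `G.indicator (D²W(z, s(z)) (s'(z), e))` of `source G W s e` when the field `s`
varies in the direction `s'`. -/
noncomputable def sourceDeriv (G : Set ℂ) (W : ℂ → ℂ → ℂ → ℂ) (s s' : ℂ → ℂ × ℂ) (e : ℂ × ℂ) :
    ℂ → ℂ :=
  G.indicator fun z => fderiv ℂ (fderiv ℂ fun σ : ℂ × ℂ => W z σ.1 σ.2) (s z) (s' z) e

/-- A derivative in a parameter is measurable, as a limit of difference quotients. -/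
theorem aestronglyMeasurable_of_hasDerivAt {𝕜 α E : Type*} [RCLike 𝕜] [MeasurableSpace α]
    {μ : Measure α} [NormedAddCommGroup E] [NormedSpace 𝕜 E] {F : 𝕜 → α → E} {F' : α → E}
    (hF : ∀ᶠ t in 𝓝 0, AEStronglyMeasurable (F t) μ)
    (h : ∀ z, HasDerivAt (fun t => F t z) (F' z) 0) : AEStronglyMeasurable F' μ := by
  classical
  -- difference quotients, replaced by zero for the values of `t` where `F t` may not be measurable
  let Q : 𝕜 → α → E := fun t z =>
    if AEStronglyMeasurable (F t) μ then t⁻¹ • (F t z - F 0 z) else 0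
  have hQ : ∀ t, AEStronglyMeasurable (Q t) μ := by
    intro t
    by_cases ht : AEStronglyMeasurable (F t) μ
    · simp only [Q, if_pos ht]
      exact (ht.sub hF.self_of_nhds).const_smul _
    · simp only [Q, if_neg ht]
      exact aestronglyMeasurable_const
  refine aestronglyMeasurable_of_tendsto_ae (𝓝[≠] (0 : 𝕜)) hQ (Eventually.of_forall fun z => ?_)
  have h1 := (h z).tendsto_slope_zero
  simp only [zero_add] at h1
  refine h1.congr' ?_
  filter_upwards [hF.filter_mono nhdsWithin_le_nhds] with t ht
  simp only [Q, if_pos ht]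

end Sources

section Family

variable {𝕜 : Type*} [RCLike 𝕜] [NormedAlgebra 𝕜 ℂ] {N : ℕ}

/-- The pair `(S₁, S₂)` of dressed fields. -/
noncomputable def field (p a b : Fin N → ℂ) (T₁ T₂ : (Fin N → 𝕜) → ℂ → ℂ) (x : Fin N → 𝕜)
    (z : ℂ) : ℂ × ℂ :=
  (vacuum p a x z + T₁ x z, vacuum p b x z + T₂ x z)

/-- The derivative of `(S₁, S₂)` in the direction `v` of the parameter space. The vacuum terms are
linear in the parameters. -/
noncomputable def fieldDeriv (p a b : Fin N → ℂ) (T₁ T₂ : (Fin N → 𝕜) → ℂ → ℂ) (x v : Fin N → 𝕜)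
    (z : ℂ) : ℂ × ℂ :=
  (vacuum p a v z + fderiv 𝕜 (fun y => T₁ y z) x v,
    vacuum p b v z + fderiv 𝕜 (fun y => T₂ y z) x v)

theorem vacuum_add_smul (p c : Fin N → ℂ) (x v : Fin N → 𝕜) (t : 𝕜) (z : ℂ) :
    vacuum p c (x + t • v) z = vacuum p c x z + t • vacuum p c v z := by
  simp only [vacuum, Pi.add_apply, Pi.smul_apply, smul_eq_mul, add_smul, mul_smul,
    Finset.sum_add_distrib, Finset.smul_sum]

theorem measurable_vacuum (p c : Fin N → ℂ) (x : Fin N → 𝕜) : Measurable (vacuum p c x) := by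
  unfold vacuum
  refine Finset.measurable_sum _ fun i _ => Measurable.const_smul ?_ (x i)
  exact measurable_const.div (measurable_id.sub_const _)

theorem continuousOn_vacuum {p : Fin N → ℂ} {s : Set ℂ} (hp : ∀ i, p i ∉ s) (c : Fin N → ℂ)
    (x : Fin N → 𝕜) : ContinuousOn (vacuum p c x) s := by
  unfold vacuum
  refine continuousOn_finsetSum _ fun i _ => ContinuousOn.const_smul ?_ (x i)
  exact continuousOn_const.div (continuousOn_id.sub continuousOn_const)
    fun z hz => sub_ne_zero.2 fun h => hp i (h ▸ hz)

theorem vacuum_single (p c : Fin N → ℂ) (i : Fin N) (z : ℂ) :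
    vacuum p c (Pi.single i (1 : 𝕜)) z = c i * (z - p i)⁻¹ := by
  rw [vacuum, Finset.sum_eq_single i]
  · rw [Pi.single_eq_same, one_smul, div_eq_mul_inv]
  · intro j _ hj
    rw [Pi.single_eq_of_ne hj, zero_smul]
  · simp

theorem IsC1Family.hasDerivAt_line {U : Set (Fin N → 𝕜)} {T : (Fin N → 𝕜) → ℂ → ℂ}
    (hT : IsC1Family U T) {x v : Fin N → 𝕜} {t : 𝕜} (hx : x + t • v ∈ U) (z : ℂ) :
    HasDerivAt (fun t : 𝕜 => T (x + t • v) z) (fderiv 𝕜 (fun y => T y z) (x + t • v) v) t := by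
  have h2 : HasDerivAt (fun t : 𝕜 => x + t • v) v t := by
    simpa using ((hasDerivAt_id t).smul_const v).const_add x
  exact (hT.differentiableAt _ hx z).hasFDerivAt.comp_hasDerivAt t h2

theorem IsC1Family.continuous {U : Set (Fin N → 𝕜)} {T : (Fin N → 𝕜) → ℂ → ℂ}
    (hT : IsC1Family U T) {x : Fin N → 𝕜} (hx : x ∈ U) : Continuous (T x) :=
  hT.continuousOn.comp_continuous (by fun_prop : Continuous fun z : ℂ => (x, z))
    fun z => ⟨hx, mem_univ z⟩

theorem IsC1Family.continuous_fderiv {U : Set (Fin N → 𝕜)} {T : (Fin N → 𝕜) → ℂ → ℂ}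
    (hT : IsC1Family U T) {x : Fin N → 𝕜} (hx : x ∈ U) (v : Fin N → 𝕜) :
    Continuous fun z => fderiv 𝕜 (fun y => T y z) x v :=
  (hT.continuousOn_fderiv.comp_continuous (by fun_prop : Continuous fun z : ℂ => (x, z))
    fun z => ⟨hx, mem_univ z⟩).clm_apply continuous_const

end Family

section Solution

variable {𝕜 : Type*} [RCLike 𝕜] [NormedAlgebra 𝕜 ℂ] {N : ℕ} {G : Set ℂ} {D : Set (ℂ × ℂ × ℂ)}
  {W : ℂ → ℂ → ℂ → ℂ} {p a b : Fin N → ℂ} {U : Set (Fin N → 𝕜)} {T₁ T₂ : (Fin N → 𝕜) → ℂ → ℂ}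

theorem hasDerivAt_field (h₁ : IsC1Family U T₁) (h₂ : IsC1Family U T₂) {x v : Fin N → 𝕜} {t : 𝕜}
    (hx : x + t • v ∈ U) (z : ℂ) :
    HasDerivAt (fun t : 𝕜 => field p a b T₁ T₂ (x + t • v) z)
      (fieldDeriv p a b T₁ T₂ (x + t • v) v z) t := by
  have h : ∀ c : Fin N → ℂ,
      HasDerivAt (fun t : 𝕜 => vacuum p c (x + t • v) z) (vacuum p c v z) t := by
    intro c
    simp only [vacuum_add_smul]
    simpa using ((hasDerivAt_id t).smul_const (vacuum p c v z)).const_add (vacuum p c x z)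
  exact ((h a).add (h₁.hasDerivAt_line hx z)).prodMk ((h b).add (h₂.hasDerivAt_line hx z))

/-- Bounds which are uniform in `z ∈ G` and in the parameters on a short segment: all that is needed
to differentiate under the integral sign. -/
theorem IsDbarSolution.exists_local_bound (hT : IsDbarSolution G D W p a b U T₁ T₂)
    (hW : IsHamiltonian G D W) (hGb : Bornology.IsBounded G) (hpG : ∀ i, p i ∉ closure G)
    (hU : IsOpen U) {x : Fin N → 𝕜} (hx : x ∈ U) (v : Fin N → 𝕜) :
    ∃ δ : ℝ, 0 < δ ∧ ∃ B : ℝ, 0 ≤ B ∧ ∀ t ∈ Metric.ball (0 : 𝕜) δ, x + t • v ∈ U ∧ ∀ z ∈ G,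
      (‖W z (field p a b T₁ T₂ (x + t • v) z).1 (field p a b T₁ T₂ (x + t • v) z).2‖ ≤ B ∧
      DifferentiableAt ℂ (fun s : ℂ × ℂ => W z s.1 s.2) (field p a b T₁ T₂ (x + t • v) z) ∧
      ‖fderiv ℂ (fun s : ℂ × ℂ => W z s.1 s.2) (field p a b T₁ T₂ (x + t • v) z)‖ ≤ B ∧
      DifferentiableAt ℂ (fderiv ℂ fun s : ℂ × ℂ => W z s.1 s.2)
        (field p a b T₁ T₂ (x + t • v) z) ∧
      ‖fderiv ℂ (fderiv ℂ fun s : ℂ × ℂ => W z s.1 s.2) (field p a b T₁ T₂ (x + t • v) z)‖ ≤ B ∧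
      ∀ u w, fderiv ℂ (fderiv ℂ fun s : ℂ × ℂ => W z s.1 s.2)
          (field p a b T₁ T₂ (x + t • v) z) u w
        = fderiv ℂ (fderiv ℂ fun s : ℂ × ℂ => W z s.1 s.2)
          (field p a b T₁ T₂ (x + t • v) z) w u) ∧
      ‖T₂ (x + t • v) z‖ ≤ B ∧
      ‖fderiv 𝕜 (fun y => T₂ y z) (x + t • v) v‖ ≤ B ∧
      ‖fieldDeriv p a b T₁ T₂ (x + t • v) v z‖ ≤ B := by
  have hline : Continuous fun t : 𝕜 => x + t • v := by fun_prop
  have hnhds : (fun t : 𝕜 => x + t • v) ⁻¹' U ∈ 𝓝 (0 : 𝕜) :=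
    (hU.preimage hline).mem_nhds (by simpa using hx)
  obtain ⟨δ, hδ, hδU⟩ := Metric.nhds_basis_closedBall.mem_iff.1 hnhds
  set K : Set (𝕜 × ℂ) := Metric.closedBall (0 : 𝕜) δ ×ˢ closure G
  have hK : IsCompact K := (isCompact_closedBall _ _).prod hGb.isCompact_closure
  have hmap : MapsTo (fun q : 𝕜 × ℂ => (x + q.1 • v, q.2)) K (U ×ˢ univ) :=
    fun q hq => ⟨hδU hq.1, mem_univ _⟩
  have hlc : Continuous fun q : 𝕜 × ℂ => (x + q.1 • v, q.2) := by fun_prop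
  have hTc : ∀ T, IsC1Family U T → ContinuousOn (fun q : 𝕜 × ℂ => T (x + q.1 • v) q.2) K :=
    fun T h => h.continuousOn.comp hlc.continuousOn hmap
  have hTd : ∀ T, IsC1Family U T →
      ContinuousOn (fun q : 𝕜 × ℂ => fderiv 𝕜 (fun y => T y q.2) (x + q.1 • v) v) K :=
    fun T h => (h.continuousOn_fderiv.comp hlc.continuousOn hmap).clm_apply continuousOn_const
  have hV : ∀ (c : Fin N → ℂ) (y : Fin N → 𝕜),
      ContinuousOn (fun q : 𝕜 × ℂ => vacuum p c y q.2) K := fun c y =>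
    (continuousOn_vacuum hpG c y).comp continuousOn_snd fun q hq => hq.2
  have hVl : ∀ (c : Fin N → ℂ),
      ContinuousOn (fun q : 𝕜 × ℂ => vacuum p c (x + q.1 • v) q.2) K := fun c => by
    simp only [vacuum_add_smul]
    exact (hV c x).add (continuousOn_fst.smul (hV c v))
  have hF : ContinuousOn (fun q : 𝕜 × ℂ => (q.2, field p a b T₁ T₂ (x + q.1 • v) q.2)) K :=
    continuousOn_snd.prodMk (((hVl a).add (hTc T₁ hT.family₁)).prodMk
      ((hVl b).add (hTc T₂ hT.family₂)))
  have hFd : ContinuousOn (fun q : 𝕜 × ℂ => fieldDeriv p a b T₁ T₂ (x + q.1 • v) v q.2) K :=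
    ((hV a v).add (hTd T₁ hT.family₁)).prodMk ((hV b v).add (hTd T₂ hT.family₂))
  obtain ⟨B₀, hB₀, hB₀'⟩ := hW.exists_bound (hK.image_of_continuousOn hF) (by
    rintro _ ⟨q, hq, rfl⟩
    exact hT.mem_domain _ (hδU hq.1) _ hq.2)
  obtain ⟨B₁, hB₁⟩ := hK.exists_bound_of_continuousOn (hTc T₂ hT.family₂)
  obtain ⟨B₂, hB₂⟩ := hK.exists_bound_of_continuousOn (hTd T₂ hT.family₂)
  obtain ⟨B₃, hB₃⟩ := hK.exists_bound_of_continuousOn hFd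
  have l₀ : B₀ ≤ max (max B₀ B₁) (max B₂ B₃) := by simp
  have l₁ : B₁ ≤ max (max B₀ B₁) (max B₂ B₃) := by simp
  have l₂ : B₂ ≤ max (max B₀ B₁) (max B₂ B₃) := by simp
  have l₃ : B₃ ≤ max (max B₀ B₁) (max B₂ B₃) := by simp
  refine ⟨δ, hδ, max (max B₀ B₁) (max B₂ B₃), hB₀.trans l₀, fun t ht =>
    ⟨hδU (Metric.ball_subset_closedBall ht), fun z hz => ?_⟩⟩
  have hq : (t, z) ∈ K := ⟨Metric.ball_subset_closedBall ht, subset_closure hz⟩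
  obtain ⟨h1, h2, h3, h4, h5, h6⟩ := hB₀' z hz _ (mem_image_of_mem _ hq)
  exact ⟨⟨h1.trans l₀, h2, h3.trans l₀, h4, h5.trans l₀, h6⟩, (hB₁ _ hq).trans l₁,
    (hB₂ _ hq).trans l₂, (hB₃ _ hq).trans l₃⟩

theorem IsDbarSolution.differentiableAt_hamiltonian (hT : IsDbarSolution G D W p a b U T₁ T₂)
    (hW : IsHamiltonian G D W) {x : Fin N → 𝕜} (hx : x ∈ U) {z : ℂ} (hz : z ∈ G) :
    DifferentiableAt ℂ (fun s : ℂ × ℂ => W z s.1 s.2) (field p a b T₁ T₂ x z) := by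
  have h : IsOpen {s : ℂ × ℂ | (z, s.1, s.2) ∈ D} := hW.isOpen_domain.preimage (by fun_prop)
  exact (hW.holomorphic z hz).differentiableAt
    (h.mem_nhds (hT.mem_domain x hx z (subset_closure hz)))

theorem IsDbarSolution.hasWeakDbar₁ (hT : IsDbarSolution G D W p a b U T₁ T₂)
    (hW : IsHamiltonian G D W) {x : Fin N → 𝕜} (hx : x ∈ U) :
    HasWeakDbar (T₁ x) (source G W (field p a b T₁ T₂ x) (0, 1)) := by
  convert hT.dbar₁ x hx using 1
  refine indicator_congr fun z hz => ?_
  have hd : HasFDerivAt (fun s : ℂ × ℂ => W z s.1 s.2) _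
      (vacuum p a x z + T₁ x z, vacuum p b x z + T₂ x z) :=
    (hT.differentiableAt_hamiltonian hW hx hz).hasFDerivAt
  have h2 : HasDerivAt (fun s : ℂ => (vacuum p a x z + T₁ x z, s)) (0, 1)
      (vacuum p b x z + T₂ x z) := (hasDerivAt_const _ _).prodMk (hasDerivAt_id _)
  exact (hd.comp_hasDerivAt _ h2).deriv.symm

theorem IsDbarSolution.hasWeakDbar₂ (hT : IsDbarSolution G D W p a b U T₁ T₂)
    (hW : IsHamiltonian G D W) {x : Fin N → 𝕜} (hx : x ∈ U) :
    HasWeakDbar (T₂ x) (source G W (field p a b T₁ T₂ x) (-1, 0)) := by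
  convert hT.dbar₂ x hx using 1
  refine indicator_congr fun z hz => ?_
  have hd : HasFDerivAt (fun s : ℂ × ℂ => W z s.1 s.2) _
      (vacuum p a x z + T₁ x z, vacuum p b x z + T₂ x z) :=
    (hT.differentiableAt_hamiltonian hW hx hz).hasFDerivAt
  have h2 : HasDerivAt (fun s : ℂ => (s, vacuum p b x z + T₂ x z)) (1, 0)
      (vacuum p a x z + T₁ x z) := (hasDerivAt_id _).prodMk (hasDerivAt_const _ _)
  have h3 : ((-1, 0) : ℂ × ℂ) = -(1, 0) := by simp
  rw [h3, map_neg, neg_inj]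
  exact (HasFDerivAt.comp_hasDerivAt
    (f := fun s : ℂ => (s, vacuum p b x z + T₂ x z)) _ hd h2).deriv.symm

theorem exists_radius_of_support {f : ℂ → ℂ} (hGb : Bornology.IsBounded G) :
    ∃ R : ℝ, ∀ z, R < ‖z‖ → G.indicator f z = 0 := by
  obtain ⟨R, hR⟩ := hGb.exists_norm_le
  exact ⟨R, fun z hz => indicator_of_notMem (fun h => absurd (hR z h) (not_le.2 hz)) f⟩

theorem isBoundedCompact_indicator {f : ℂ → ℂ} (hGb : Bornology.IsBounded G)
    (hm : AEStronglyMeasurable (G.indicator f)) {M : ℝ} (hM0 : 0 ≤ M) (hM : ∀ z ∈ G, ‖f z‖ ≤ M) :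
    IsBoundedCompact (G.indicator f) := by
  refine ⟨hm, ⟨M, fun z => ?_⟩, exists_radius_of_support hGb⟩
  by_cases hz : z ∈ G
  · rw [indicator_of_mem hz]; exact hM z hz
  · rw [indicator_of_notMem hz, norm_zero]; exact hM0

theorem IsDbarSolution.isBoundedCompact_source (hT : IsDbarSolution G D W p a b U T₁ T₂)
    (hW : IsHamiltonian G D W) (hGb : Bornology.IsBounded G) (hpG : ∀ i, p i ∉ closure G)
    (hU : IsOpen U) {x : Fin N → 𝕜} (hx : x ∈ U) {e : ℂ × ℂ} {T : ℂ → ℂ}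
    (h : HasWeakDbar T (source G W (field p a b T₁ T₂ x) e)) :
    IsBoundedCompact (source G W (field p a b T₁ T₂ x) e) := by
  obtain ⟨δ, hδ, B, hB, hb⟩ := hT.exists_local_bound hW hGb hpG hU hx 0
  refine isBoundedCompact_indicator hGb h.2.1.aestronglyMeasurable (M := B * ‖e‖) (by positivity)
    fun z hz => ?_
  have h1 := ((hb 0 (Metric.mem_ball_self hδ)).2 z hz).1.2.2.1
  rw [smul_zero, add_zero] at h1
  exact (ContinuousLinearMap.le_opNorm _ _).trans (by gcongr)

theorem hasDerivAt_source (h₁ : IsC1Family U T₁) (h₂ : IsC1Family U T₂) {x v : Fin N → 𝕜} {t : 𝕜}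
    (hx : x + t • v ∈ U) (e : ℂ × ℂ)
    (hd : ∀ z ∈ G, DifferentiableAt ℂ (fderiv ℂ fun s : ℂ × ℂ => W z s.1 s.2)
        (field p a b T₁ T₂ (x + t • v) z)) (z : ℂ) :
    HasDerivAt (fun t : 𝕜 => source G W (field p a b T₁ T₂ (x + t • v)) e z)
      (sourceDeriv G W (field p a b T₁ T₂ (x + t • v)) (fieldDeriv p a b T₁ T₂ (x + t • v) v) e z)
      t := by
  by_cases hz : z ∈ G
  · simp only [source, sourceDeriv, indicator_of_mem hz]
    have h3 := ((hd z hz).hasFDerivAt.clm_apply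
      (hasFDerivAt_const e (field p a b T₁ T₂ (x + t • v) z))).restrictScalars 𝕜
    refine (h3.comp_hasDerivAt t (hasDerivAt_field h₁ h₂ hx z)).congr_deriv ?_
    simp
  · simp only [source, sourceDeriv, indicator_of_notMem hz]
    exact hasDerivAt_const _ _

/-- The linearized `∂̄`-problem in integral form: the derivative of `T` in the direction `v` is the
Cauchy transform of the variation of its source. The statement covers both `T₁` and
`T₂`, through the choice of `e`. -/
theorem IsDbarSolution.fderiv_eq_cauchyTransform (hT : IsDbarSolution G D W p a b U T₁ T₂)
    (hW : IsHamiltonian G D W) (hG : MeasurableSet G) (hGb : Bornology.IsBounded G)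
    (hpG : ∀ i, p i ∉ closure G)
    (hU : IsOpen U) {e : ℂ × ℂ} {T : (Fin N → 𝕜) → ℂ → ℂ} (hTC : IsC1Family U T)
    (h : ∀ x ∈ U, HasWeakDbar (T x) (source G W (field p a b T₁ T₂ x) e))
    (h0 : ∀ x ∈ U, Tendsto (T x) (cocompact ℂ) (𝓝 0))
    {x : Fin N → 𝕜} (hx : x ∈ U) (v : Fin N → 𝕜) :
    IsBoundedCompact
      (sourceDeriv G W (field p a b T₁ T₂ x) (fieldDeriv p a b T₁ T₂ x v) e) ∧
    ∀ w, fderiv 𝕜 (fun y => T y w) x v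
      = cauchyTransform
          (sourceDeriv G W (field p a b T₁ T₂ x) (fieldDeriv p a b T₁ T₂ x v) e) w := by
  obtain ⟨δ, hδ, B, hB, hb⟩ := hT.exists_local_bound hW hGb hpG hU hx v
  have hs := fun t (ht : t ∈ Metric.ball (0 : 𝕜) δ) =>
    hT.isBoundedCompact_source hW hGb hpG hU (hb t ht).1 (h _ (hb t ht).1)
  have hd := fun t (ht : t ∈ Metric.ball (0 : 𝕜) δ) (z : ℂ) =>
    hasDerivAt_source (p := p) (a := a) (b := b) (G := G) (W := W) hT.family₁ hT.family₂
      (hb t ht).1 e (fun z hz => ((hb t ht).2 z hz).1.2.2.2.1) z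
  have h00 : (0 : 𝕜) ∈ Metric.ball (0 : 𝕜) δ := Metric.mem_ball_self hδ
  have hx0 : x + (0 : 𝕜) • v = x := by simp
  have hbd : ∀ t ∈ Metric.ball (0 : 𝕜) δ, ∀ z,
      ‖sourceDeriv G W (field p a b T₁ T₂ (x + t • v)) (fieldDeriv p a b T₁ T₂ (x + t • v) v) e z‖
        ≤ G.indicator (fun _ => B * B * ‖e‖) z := by
    intro t ht z
    by_cases hz : z ∈ G
    · simp only [sourceDeriv, indicator_of_mem hz]
      obtain ⟨h1, _, _, h2⟩ := (hb t ht).2 z hz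
      exact (ContinuousLinearMap.le_opNorm₂ _ _ _).trans (by gcongr; exact h1.2.2.2.2.1)
    · simp only [sourceDeriv, indicator_of_notMem hz, norm_zero, le_refl]
  have hm : AEStronglyMeasurable
      (sourceDeriv G W (field p a b T₁ T₂ x) (fieldDeriv p a b T₁ T₂ x v) e) := by
    refine aestronglyMeasurable_of_hasDerivAt (𝕜 := 𝕜)
      (F := fun t => source G W (field p a b T₁ T₂ (x + t • v)) e) ?_ ?_
    · filter_upwards [Metric.ball_mem_nhds (0 : 𝕜) hδ] with t ht using (hs t ht).1
    · intro z
      simpa only [hx0] using hd 0 h00 z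
  have hB' : IsBoundedCompact
      (sourceDeriv G W (field p a b T₁ T₂ x) (fieldDeriv p a b T₁ T₂ x v) e) := by
    refine isBoundedCompact_indicator hGb hm (M := B * B * ‖e‖) (by positivity) fun z hz => ?_
    have := hbd 0 h00 z
    simpa only [hx0, sourceDeriv, indicator_of_mem hz] using this
  refine ⟨hB', fun w => ?_⟩
  have hrep : ∀ t ∈ Metric.ball (0 : 𝕜) δ, T (x + t • v) w
      = cauchyTransform (source G W (field p a b T₁ T₂ (x + t • v)) e) w := fun t ht =>
    (h _ (hb t ht).1).eq_cauchyTransform (hTC.continuous (hb t ht).1) (h0 _ (hb t ht).1) (hs t ht) w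
  have h1 : HasDerivAt (fun t : 𝕜 => T (x + t • v) w) (fderiv 𝕜 (fun y => T y w) x v) 0 := by
    have := hTC.hasDerivAt_line (x := x) (v := v) (t := 0) (by rwa [hx0]) w
    rwa [hx0] at this
  have hbi : Integrable fun z => G.indicator (fun _ => B * B * ‖e‖) z * ‖(w - z)⁻¹‖ := by
    have h2 : IsBoundedCompact (G.indicator fun _ => ((B * B * ‖e‖ : ℝ) : ℂ)) :=
      isBoundedCompact_indicator hGb (measurable_const.indicator hG).aestronglyMeasurable
        (M := B * B * ‖e‖) (by positivity) fun z _ => by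
          rw [Complex.norm_real, Real.norm_of_nonneg (by positivity)]
    refine (h2.integrable_mul_inv w).norm.congr (Eventually.of_forall fun z => ?_)
    simp only [norm_mul, norm_indicator_eq_indicator_norm, Complex.norm_real, norm_norm,
      Real.norm_of_nonneg hB]
  have h2 := (hasDerivAt_integral_of_dominated_loc_of_deriv_le (μ := volume)
    (F := fun t z => source G W (field p a b T₁ T₂ (x + t • v)) e z * (w - z)⁻¹)
    (F' := fun t z => sourceDeriv G W (field p a b T₁ T₂ (x + t • v))
      (fieldDeriv p a b T₁ T₂ (x + t • v) v) e z * (w - z)⁻¹)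
    (bound := fun z => G.indicator (fun _ => B * B * ‖e‖) z * ‖(w - z)⁻¹‖)
    (Metric.ball_mem_nhds (0 : 𝕜) hδ) ?_ ?_ ?_ ?_ hbi ?_).2
  · simp only [hx0] at h2
    refine h1.unique ((h2.const_mul (Real.pi : ℂ)⁻¹).congr_of_eventuallyEq ?_)
    filter_upwards [Metric.ball_mem_nhds (0 : 𝕜) hδ] with t ht using hrep t ht
  · filter_upwards [Metric.ball_mem_nhds (0 : 𝕜) hδ] with t ht
    exact ((hs t ht).integrable_mul_inv w).aestronglyMeasurable
  · exact (hs 0 h00).integrable_mul_inv w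
  · simp only [hx0]
    exact (hB'.integrable_mul_inv w).aestronglyMeasurable
  · refine Eventually.of_forall fun z t ht => ?_
    rw [norm_mul]
    gcongr
    exact hbd t ht z
  · refine Eventually.of_forall fun z t ht => ?_
    exact (hd t ht z).mul_const _

end Solution

/-! ### The first variation of the action -/

section Action

variable {𝕜 : Type*} [RCLike 𝕜] [NormedAlgebra 𝕜 ℂ] {N : ℕ} {G : Set ℂ} {D : Set (ℂ × ℂ × ℂ)}
  {W : ℂ → ℂ → ℂ → ℂ} {p a b : Fin N → ℂ} {U : Set (Fin N → 𝕜)} {T₁ T₂ : (Fin N → 𝕜) → ℂ → ℂ}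

/-- The Hamiltonian along a field `s`, extended by zero outside `G`. -/
noncomputable def hamiltonianAlong (G : Set ℂ) (W : ℂ → ℂ → ℂ → ℂ) (s : ℂ → ℂ × ℂ) : ℂ → ℂ :=
  G.indicator fun z => W z (s z).1 (s z).2

theorem IsDbarSolution.isBoundedCompact_hamiltonianAlong
    (hT : IsDbarSolution G D W p a b U T₁ T₂) (hW : IsHamiltonian G D W)
    (hGb : Bornology.IsBounded G) (hpG : ∀ i, p i ∉ closure G)
    (hU : IsOpen U) {x : Fin N → 𝕜} (hx : x ∈ U) :
    IsBoundedCompact (hamiltonianAlong G W (field p a b T₁ T₂ x)) := by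
  obtain ⟨δ, hδ, B, hB, hb⟩ := hT.exists_local_bound hW hGb hpG hU hx 0
  refine isBoundedCompact_indicator hGb ?_ hB fun z hz => ?_
  · have h1 : Measurable fun z => (z, vacuum p a x z + T₁ x z, vacuum p b x z + T₂ x z) :=
      measurable_id.prodMk
        (((measurable_vacuum p a x).add (hT.family₁.continuous hx).measurable).prodMk
          ((measurable_vacuum p b x).add (hT.family₂.continuous hx).measurable))
    refine (hW.measurable.comp h1).aestronglyMeasurable.congr (Eventually.of_forall fun z => ?_)
    by_cases hz : z ∈ G
    · rw [indicator_of_mem hz, Function.comp, indicator_of_mem]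
      · rfl
      · exact ⟨hT.mem_domain x hx z (subset_closure hz), hz⟩
    · rw [indicator_of_notMem hz, Function.comp, indicator_of_notMem]
      exact fun h => hz h.2
  · have h1 := ((hb 0 (Metric.mem_ball_self hδ)).2 z hz).1.1
    rwa [smul_zero, add_zero] at h1

theorem IsDbarSolution.indicator_actionDensity_ae_eq (hT : IsDbarSolution G D W p a b U T₁ T₂)
    (hW : IsHamiltonian G D W) {x : Fin N → 𝕜} (hx : x ∈ U) :
    G.indicator (actionDensity W (vacuum p a x) (vacuum p b x) (T₁ x) (T₂ x))
      =ᵐ[volume] fun z => T₂ x z * source G W (field p a b T₁ T₂ x) (0, 1) z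
        - hamiltonianAlong G W (field p a b T₁ T₂ x) z := by
  filter_upwards [(hT.hasWeakDbar₁ hW hx).weakDbar_ae_eq] with z hz
  by_cases hzG : z ∈ G
  · rw [indicator_of_mem hzG, actionDensity, hz, hamiltonianAlong, indicator_of_mem hzG]
    rfl
  · rw [indicator_of_notMem hzG, source, hamiltonianAlong, indicator_of_notMem hzG,
      indicator_of_notMem hzG, mul_zero, sub_zero]

theorem IsDbarSolution.integrable_density (hT : IsDbarSolution G D W p a b U T₁ T₂)
    (hW : IsHamiltonian G D W) (hGb : Bornology.IsBounded G) (hpG : ∀ i, p i ∉ closure G)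
    (hU : IsOpen U) {x : Fin N → 𝕜} (hx : x ∈ U) :
    Integrable fun z => T₂ x z * source G W (field p a b T₁ T₂ x) (0, 1) z
        - hamiltonianAlong G W (field p a b T₁ T₂ x) z :=
  (((hT.isBoundedCompact_source hW hGb hpG hU hx (hT.hasWeakDbar₁ hW hx)).continuous_mul
    (hT.family₂.continuous hx)).integrable).sub
      (hT.isBoundedCompact_hamiltonianAlong hW hGb hpG hU hx).integrable

theorem IsDbarSolution.integrableOn_actionDensity (hT : IsDbarSolution G D W p a b U T₁ T₂)
    (hW : IsHamiltonian G D W) (hG : MeasurableSet G) (hGb : Bornology.IsBounded G)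
    (hpG : ∀ i, p i ∉ closure G) (hU : IsOpen U) {x : Fin N → 𝕜} (hx : x ∈ U) :
    IntegrableOn (actionDensity W (vacuum p a x) (vacuum p b x) (T₁ x) (T₂ x)) G :=
  (integrable_indicator_iff hG).1 ((hT.integrable_density hW hGb hpG hU hx).congr
    (hT.indicator_actionDensity_ae_eq hW hx).symm)

theorem IsDbarSolution.action_eq (hT : IsDbarSolution G D W p a b U T₁ T₂)
    (hW : IsHamiltonian G D W) (hG : MeasurableSet G) {x : Fin N → 𝕜} (hx : x ∈ U) :
    action G W (vacuum p a x) (vacuum p b x) (T₁ x) (T₂ x)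
      = -(Real.pi : ℂ)⁻¹ * ∫ z, (T₂ x z * source G W (field p a b T₁ T₂ x) (0, 1) z
        - hamiltonianAlong G W (field p a b T₁ T₂ x) z) := by
  rw [action, wedgeIntegral, integral_const_mul, ← integral_indicator hG,
    integral_congr_ae (hT.indicator_actionDensity_ae_eq hW hx)]
  have hpi : (Real.pi : ℂ) ≠ 0 := by exact_mod_cast Real.pi_ne_zero
  have hI := Complex.I_ne_zero
  field_simp

theorem integral_inv_sub_mul (f : ℂ → ℂ) (w : ℂ) :
    ∫ z, (z - w)⁻¹ * f z = -Real.pi * cauchyTransform f w := by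
  have hpi : (Real.pi : ℂ) ≠ 0 := by exact_mod_cast Real.pi_ne_zero
  rw [cauchyTransform, ← mul_assoc, neg_mul, mul_inv_cancel₀ hpi, neg_one_mul, ← integral_neg]
  refine integral_congr_ae (Eventually.of_forall fun z => ?_)
  simp only
  rw [← neg_sub w z, inv_neg]
  ring

theorem IsBoundedCompact.integrable_inv_sub_mul {f : ℂ → ℂ} (hf : IsBoundedCompact f) (w : ℂ) :
    Integrable fun z => (z - w)⁻¹ * f z := by
  refine (hf.integrable_mul_inv w).neg.congr (Eventually.of_forall fun z => ?_)
  simp only [Pi.neg_apply]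
  rw [← neg_sub w z, inv_neg]
  ring

theorem vacuum_mul_eq (c : Fin N → ℂ) (v : Fin N → 𝕜) (f : ℂ → ℂ) :
    (fun z => vacuum p c v z * f z) = fun z => ∑ i, v i • (c i * ((z - p i)⁻¹ * f z)) := by
  funext z
  rw [vacuum, Finset.sum_mul]
  refine Finset.sum_congr rfl fun i _ => ?_
  rw [smul_mul_assoc, div_eq_mul_inv, mul_assoc]

theorem IsBoundedCompact.integrable_vacuum_mul {f : ℂ → ℂ} (hf : IsBoundedCompact f)
    (c : Fin N → ℂ) (v : Fin N → 𝕜) : Integrable fun z => vacuum p c v z * f z := by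
  rw [vacuum_mul_eq]
  refine integrable_finsetSum _ fun i _ => ?_
  exact ((hf.integrable_inv_sub_mul (p i)).const_mul (c i)).smul (v i)

theorem IsBoundedCompact.integral_vacuum_mul {f : ℂ → ℂ} (hf : IsBoundedCompact f)
    (c : Fin N → ℂ) (v : Fin N → 𝕜) :
    ∫ z, vacuum p c v z * f z = -Real.pi * ∑ i, v i • (c i * cauchyTransform f (p i)) := by
  have hi : ∀ i, Integrable fun z => v i • (c i * ((z - p i)⁻¹ * f z)) := fun i =>
    ((hf.integrable_inv_sub_mul (p i)).const_mul (c i)).smul (v i)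
  rw [vacuum_mul_eq, integral_finsetSum _ fun i _ => hi i, Finset.mul_sum]
  refine Finset.sum_congr rfl fun i _ => ?_
  rw [integral_smul, integral_const_mul, integral_inv_sub_mul, mul_smul_comm]
  congr 1
  ring

/-- The first variation of the action on solutions. The fields `T₁`, `T₂` enter through a
stationary expression, by antisymmetry of the Cauchy transform, so that only the explicit
dependence through the vacuum terms contributes; the corresponding integrals are values of `T₁` and
`T₂` at the poles. -/
theorem IsDbarSolution.hasDerivAt_action (hT : IsDbarSolution G D W p a b U T₁ T₂)
    (hW : IsHamiltonian G D W) (hG : MeasurableSet G) (hGb : Bornology.IsBounded G)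
    (hpG : ∀ i, p i ∉ closure G) (hU : IsOpen U) {x : Fin N → 𝕜} (hx : x ∈ U) (v : Fin N → 𝕜) :
    HasDerivAt (fun t : 𝕜 => action G W (vacuum p a (x + t • v)) (vacuum p b (x + t • v))
        (T₁ (x + t • v)) (T₂ (x + t • v)))
      (∑ i, v i • (a i * T₂ x (p i) - b i * T₁ x (p i))) 0 := by
  obtain ⟨δ, hδ, B, hB, hb⟩ := hT.exists_local_bound hW hGb hpG hU hx v
  have h00 : (0 : 𝕜) ∈ Metric.ball (0 : 𝕜) δ := Metric.mem_ball_self hδ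
  have hx0 : x + (0 : 𝕜) • v = x := by simp
  set s : 𝕜 → ℂ → ℂ × ℂ := fun t => field p a b T₁ T₂ (x + t • v) with hs
  set s' : 𝕜 → ℂ → ℂ × ℂ := fun t => fieldDeriv p a b T₁ T₂ (x + t • v) v with hs'
  have hs0 : s 0 = field p a b T₁ T₂ x := by simp only [hs, hx0]
  have hs'0 : s' 0 = fieldDeriv p a b T₁ T₂ x v := by simp only [hs', hx0]
  -- the formal derivative of the density `T₂ f₁ - W`, at the parameter value `x + t v`
  let F' : 𝕜 → ℂ → ℂ := fun t z =>
    fderiv 𝕜 (fun y => T₂ y z) (x + t • v) v * source G W (s t) (0, 1) z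
      + T₂ (x + t • v) z * sourceDeriv G W (s t) (s' t) (0, 1) z
      - G.indicator (fun z => fderiv ℂ (fun σ : ℂ × ℂ => W z σ.1 σ.2) (s t z) (s' t z)) z
  have hd : ∀ t ∈ Metric.ball (0 : 𝕜) δ, ∀ z, HasDerivAt
      (fun t => T₂ (x + t • v) z * source G W (s t) (0, 1) z - hamiltonianAlong G W (s t) z)
      (F' t z) t := by
    intro t ht z
    refine ((hT.family₂.hasDerivAt_line (hb t ht).1 z).mul
      (hasDerivAt_source hT.family₁ hT.family₂ (hb t ht).1 (0, 1)
        (fun z hz => ((hb t ht).2 z hz).1.2.2.2.1) z)).sub ?_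
    by_cases hz : z ∈ G
    · simp only [hamiltonianAlong, indicator_of_mem hz]
      exact ((((hb t ht).2 z hz).1.2.1).hasFDerivAt.restrictScalars 𝕜).comp_hasDerivAt t
        (hasDerivAt_field hT.family₁ hT.family₂ (hb t ht).1 z)
    · simp only [hamiltonianAlong, indicator_of_notMem hz]
      exact hasDerivAt_const _ _
  have hbd : ∀ t ∈ Metric.ball (0 : 𝕜) δ, ∀ z, ‖F' t z‖
      ≤ G.indicator (fun _ => B * (B * 1) + B * (B * B * 1) + B * B) z := by
    intro t ht z
    by_cases hz : z ∈ G
    · obtain ⟨⟨_, _, h1, _, h2, _⟩, h3, h4, h5⟩ := (hb t ht).2 z hz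
      have he : ‖((0, 1) : ℂ × ℂ)‖ = 1 := by simp [Prod.norm_def]
      simp only [F', source, sourceDeriv, indicator_of_mem hz]
      refine (norm_sub_le _ _).trans (add_le_add ((norm_add_le _ _).trans (add_le_add ?_ ?_)) ?_)
      · rw [norm_mul]
        gcongr
        refine (ContinuousLinearMap.le_opNorm _ _).trans ?_
        rw [he]
        gcongr
      · rw [norm_mul]
        gcongr
        refine (ContinuousLinearMap.le_opNorm₂ _ _ _).trans ?_
        rw [he]
        gcongr
      · exact (ContinuousLinearMap.le_opNorm _ _).trans (by gcongr)
    · simp only [F', source, sourceDeriv, indicator_of_notMem hz]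
      simp
  have hbi : Integrable (G.indicator fun _ => B * (B * 1) + B * (B * B * 1) + B * B) :=
    (integrable_indicator_iff hG).2 (integrableOn_const hGb.measure_lt_top.ne)
  have hint := fun t (ht : t ∈ Metric.ball (0 : 𝕜) δ) =>
    hT.integrable_density hW hGb hpG hU (hb t ht).1
  have hm : AEStronglyMeasurable (F' 0) volume := by
    refine aestronglyMeasurable_of_hasDerivAt (𝕜 := 𝕜) ?_ (hd 0 h00)
    filter_upwards [Metric.ball_mem_nhds (0 : 𝕜) hδ] with t ht using (hint t ht).1
  have key := (hasDerivAt_integral_of_dominated_loc_of_deriv_le (μ := volume)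
    (F := fun t z => T₂ (x + t • v) z * source G W (s t) (0, 1) z - hamiltonianAlong G W (s t) z)
    (F' := F') (Metric.ball_mem_nhds (0 : 𝕜) hδ)
    (by filter_upwards [Metric.ball_mem_nhds (0 : 𝕜) hδ] with t ht using (hint t ht).1)
    (hint 0 h00) hm (Eventually.of_forall fun z t ht => hbd t ht z) hbi
    (Eventually.of_forall fun z t ht => hd t ht z)).2
  have hact := (key.const_mul (-(Real.pi : ℂ)⁻¹)).congr_of_eventuallyEq
    (f₁ := fun t : 𝕜 => action G W (vacuum p a (x + t • v)) (vacuum p b (x + t • v))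
        (T₁ (x + t • v)) (T₂ (x + t • v))) (by
      filter_upwards [Metric.ball_mem_nhds (0 : 𝕜) hδ] with t ht
      exact hT.action_eq hW hG (hb t ht).1)
  refine hact.congr_deriv ?_
  -- regroup the derivative at `t = 0`: on `G`, `DW (δS) = f₁ δS₂ - f₂ δS₁`, so that
  -- `f₁ δT₂` cancels
  have hf₁ := hT.isBoundedCompact_source hW hGb hpG hU hx (hT.hasWeakDbar₁ hW hx)
  have hf₂ := hT.isBoundedCompact_source hW hGb hpG hU hx (hT.hasWeakDbar₂ hW hx)
  obtain ⟨hg₁, hg₁'⟩ := hT.fderiv_eq_cauchyTransform hW hG hGb hpG hU hT.family₁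
    (fun x hx => hT.hasWeakDbar₁ hW hx) hT.zero_at_infty₁ hx v
  have hc₁ := fun w => (hT.hasWeakDbar₁ hW hx).eq_cauchyTransform (hT.family₁.continuous hx)
    (hT.zero_at_infty₁ x hx) hf₁ w
  have hc₂ := fun w => (hT.hasWeakDbar₂ hW hx).eq_cauchyTransform (hT.family₂.continuous hx)
    (hT.zero_at_infty₂ x hx) hf₂ w
  set f₁ := source G W (field p a b T₁ T₂ x) (0, 1)
  set f₂ := source G W (field p a b T₁ T₂ x) (-1, 0)
  set g₁ := sourceDeriv G W (field p a b T₁ T₂ x) (fieldDeriv p a b T₁ T₂ x v) (0, 1)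
  have hF0 : ∀ z, F' 0 z = g₁ z * cauchyTransform f₂ z + f₂ z * cauchyTransform g₁ z
      + (vacuum p a v z * f₂ z - vacuum p b v z * f₁ z) := by
    intro z
    simp only [F', hs0, hs'0, hx0]
    rw [← hc₂, ← hg₁']
    by_cases hz : z ∈ G
    · simp only [f₁, f₂, g₁, source, indicator_of_mem hz]
      have e : fieldDeriv p a b T₁ T₂ x v z
          = -((fieldDeriv p a b T₁ T₂ x v z).1 • ((-1, 0) : ℂ × ℂ))
            + (fieldDeriv p a b T₁ T₂ x v z).2 • ((0, 1) : ℂ × ℂ) := by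
        ext <;> simp
      have e2 := congrArg (fderiv ℂ (fun σ : ℂ × ℂ => W z σ.1 σ.2) (field p a b T₁ T₂ x z)) e
      rw [map_add, map_neg, map_smul, map_smul, smul_eq_mul, smul_eq_mul] at e2
      rw [e2]
      simp only [fieldDeriv]
      ring
    · simp only [f₁, f₂, g₁, source, sourceDeriv, indicator_of_notMem hz]
      ring
  have hi1 : Integrable fun z => g₁ z * cauchyTransform f₂ z := by
    refine (hg₁.continuous_mul (hT.family₂.continuous hx)).integrable.congr
      (Eventually.of_forall fun z => ?_)
    simp only
    rw [← hc₂, mul_comm]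
  have hi2 : Integrable fun z => f₂ z * cauchyTransform g₁ z := by
    refine (hf₂.continuous_mul (hT.family₁.continuous_fderiv hx v)).integrable.congr
      (Eventually.of_forall fun z => ?_)
    simp only
    rw [← hg₁', mul_comm]
  have hpi : (Real.pi : ℂ) ≠ 0 := by exact_mod_cast Real.pi_ne_zero
  have hv1 := hf₂.integrable_vacuum_mul (p := p) a v
  have hv2 := hf₁.integrable_vacuum_mul (p := p) b v
  have hI := (integral_congr_ae (Eventually.of_forall hF0)).trans
    ((integral_add (hi1.add hi2) (hv1.sub hv2)).trans
      (congrArg₂ (· + ·) (integral_add hi1 hi2) (integral_sub hv1 hv2)))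
  rw [hI, IsBoundedCompact.integral_mul_cauchyTransform hg₁ hf₂, neg_add_cancel, zero_add,
    hf₂.integral_vacuum_mul, hf₁.integral_vacuum_mul, ← mul_sub, ← mul_assoc, neg_mul_neg,
    inv_mul_cancel₀ hpi, one_mul, ← Finset.sum_sub_distrib]
  refine Finset.sum_congr rfl fun i _ => ?_
  rw [← hc₁, ← hc₂, smul_sub]

end Action

/-! ### The potential and its derivatives -/

section Potential

/-- A function whose derivatives along lines are given by a continuous family of linear maps is
differentiable. -/
theorem hasFDerivAt_of_hasDerivAt_line {𝕜 : Type*} [RCLike 𝕜]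
    {E : Type*} [NormedAddCommGroup E] [NormedSpace 𝕜 E]
    {F : Type*} [NormedAddCommGroup F] [NormedSpace 𝕜 F]
    {f : E → F} {L : E → E →L[𝕜] F} {U : Set E} (hU : IsOpen U)
    (hL : ContinuousOn L U)
    (h : ∀ x ∈ U, ∀ v, HasDerivAt (fun t : 𝕜 => f (x + t • v)) (L x v) 0) {x : E} (hx : x ∈ U) :
    HasFDerivAt f (L x) x := by
  rw [hasFDerivAt_iff_isLittleO, Asymptotics.isLittleO_iff]
  intro ε hε
  have h1 : ∀ᶠ y in 𝓝 x, y ∈ U ∧ ‖L y - L x‖ ≤ ε := by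
    have h2 := (hL.continuousAt (hU.mem_nhds hx)).eventually (Metric.closedBall_mem_nhds (L x) hε)
    filter_upwards [hU.mem_nhds hx, h2] with y hyU hy
    exact ⟨hyU, mem_closedBall_iff_norm.1 hy⟩
  obtain ⟨r, hr, hrs⟩ := Metric.eventually_nhds_iff_ball.1 h1
  filter_upwards [Metric.ball_mem_nhds x hr] with y hy
  have hseg : ∀ t ∈ Metric.closedBall (0 : 𝕜) 1, x + t • (y - x) ∈ Metric.ball x r := by
    intro t ht
    rw [mem_closedBall_zero_iff] at ht
    rw [mem_ball_iff_norm] at hy ⊢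
    rw [add_sub_cancel_left, norm_smul]
    exact lt_of_le_of_lt (mul_le_of_le_one_left (norm_nonneg _) ht) hy
  have hder : ∀ t ∈ Metric.closedBall (0 : 𝕜) 1,
      HasDerivWithinAt (fun t : 𝕜 => f (x + t • (y - x)) - t • L x (y - x))
        (L (x + t • (y - x)) (y - x) - L x (y - x)) (Metric.closedBall (0 : 𝕜) 1) t := by
    intro t ht
    have h2 := h _ (hrs _ (hseg t ht)).1 (y - x)
    have h3 : HasDerivAt (fun τ : 𝕜 => f (x + τ • (y - x))) (L (x + t • (y - x)) (y - x)) t := by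
      have h4 : HasDerivAt (fun τ : 𝕜 => τ - t) 1 t := (hasDerivAt_id t).sub_const t
      have h5 := HasDerivAt.scomp (h := fun τ : 𝕜 => τ - t) t (by rwa [sub_self]) h4
      rw [one_smul] at h5
      refine h5.congr_of_eventuallyEq (Eventually.of_forall fun τ => ?_)
      simp only [Function.comp]
      congr 1
      module
    have h6 : HasDerivAt (fun τ : 𝕜 => τ • L x (y - x)) (L x (y - x)) t := by
      simpa using (hasDerivAt_id t).smul_const (L x (y - x))
    exact (h3.sub h6).hasDerivWithinAt
  have h7 := Convex.norm_image_sub_le_of_norm_hasDerivWithin_le (C := ε * ‖y - x‖) hder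
    (fun t ht => by
      rw [← sub_apply]
      exact (ContinuousLinearMap.le_opNorm _ _).trans
        (by gcongr; exact (hrs _ (hseg t ht)).2))
    (convex_closedBall (0 : 𝕜) 1) (Metric.mem_closedBall_self zero_le_one)
    (by simp : (1 : 𝕜) ∈ Metric.closedBall (0 : 𝕜) 1)
  simpa [sub_right_comm] using h7

variable {𝕜 : Type*} [RCLike 𝕜] [NormedAlgebra 𝕜 ℂ] {N : ℕ} {G : Set ℂ} {D : Set (ℂ × ℂ × ℂ)}
  {W : ℂ → ℂ → ℂ → ℂ} {p a b : Fin N → ℂ} {U : Set (Fin N → 𝕜)} {T₁ T₂ : (Fin N → 𝕜) → ℂ → ℂ}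

/-- The coefficient of `x_i x_j` in the vacuum potential. On the diagonal it is `0 / 0 = 0`, so that
sums may run over all pairs of indices. -/
noncomputable def vacuumCoeff (p a b : Fin N → ℂ) (i j : Fin N) : ℂ :=
  (a i * b j - a j * b i) / (p i - p j)

theorem vacuumCoeff_symm (p a b : Fin N → ℂ) (i j : Fin N) :
    vacuumCoeff p a b i j = vacuumCoeff p a b j i := by
  rw [vacuumCoeff, vacuumCoeff, ← neg_sub (p j), ← neg_sub (a j * b i), neg_div_neg_eq]

theorem vacuumCoeff_self (p a b : Fin N → ℂ) (i : Fin N) : vacuumCoeff p a b i i = 0 := by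
  simp [vacuumCoeff]

theorem vacuumPotential_eq (p a b : Fin N → ℂ) (x : Fin N → 𝕜) :
    vacuumPotential p a b x = (1 / 2) * ∑ i, ∑ j, (x i * x j) • vacuumCoeff p a b i j := by
  rw [vacuumPotential]
  congr 1
  refine Finset.sum_congr rfl fun i _ => ?_
  rw [← Finset.add_sum_erase _ _ (Finset.mem_univ i), vacuumCoeff_self, smul_zero, zero_add]
  rfl

theorem hasDerivAt_vacuumPotential (p a b : Fin N → ℂ) (x v : Fin N → 𝕜) :
    HasDerivAt (fun t : 𝕜 => vacuumPotential p a b (x + t • v))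
      (∑ i, v i • ∑ j, x j • vacuumCoeff p a b i j) 0 := by
  simp only [vacuumPotential_eq]
  have h1 : ∀ i, HasDerivAt (fun t : 𝕜 => (x + t • v) i) (v i) 0 := fun i => by
    simpa using ((hasDerivAt_id (0 : 𝕜)).mul_const (v i)).const_add (x i)
  have h2 := (HasDerivAt.fun_sum (u := Finset.univ) fun i _ =>
    HasDerivAt.fun_sum (u := Finset.univ) fun j _ =>
      ((h1 i).mul (h1 j)).smul_const (vacuumCoeff p a b i j)).const_mul (1 / 2 : ℂ)
  refine h2.congr_deriv ?_
  simp only [zero_smul, add_zero, add_smul, Finset.sum_add_distrib, Finset.smul_sum, mul_smul]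
  have h3 : ∑ i, ∑ j, x i • v j • vacuumCoeff p a b i j
      = ∑ i, ∑ j, v i • x j • vacuumCoeff p a b i j := by
    rw [Finset.sum_comm]
    refine Finset.sum_congr rfl fun i _ => Finset.sum_congr rfl fun j _ => ?_
    rw [vacuumCoeff_symm, smul_comm]
  rw [h3]
  ring

/-- The partial derivatives of the potential: the vacuum part, plus the values of `T₁`, `T₂` at the
poles of the vacuum terms. -/
noncomputable def potentialGradient (p a b : Fin N → ℂ) (T₁ T₂ : (Fin N → 𝕜) → ℂ → ℂ) (i : Fin N)
    (x : Fin N → 𝕜) : ℂ :=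
  (∑ j, x j • vacuumCoeff p a b i j) + (a i * T₂ x (p i) - b i * T₁ x (p i))

theorem hasFDerivAt_potentialGradient (h₁ : IsC1Family U T₁) (h₂ : IsC1Family U T₂) (i : Fin N)
    {x : Fin N → 𝕜} (hx : x ∈ U) :
    HasFDerivAt (potentialGradient p a b T₁ T₂ i)
      ((∑ j, (ContinuousLinearMap.proj j : (Fin N → 𝕜) →L[𝕜] 𝕜).smulRight (vacuumCoeff p a b i j))
        + (a i • fderiv 𝕜 (fun y => T₂ y (p i)) x - b i • fderiv 𝕜 (fun y => T₁ y (p i)) x)) x := by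
  refine HasFDerivAt.add (HasFDerivAt.fun_sum fun j _ => ?_) (HasFDerivAt.sub ?_ ?_)
  · exact ((ContinuousLinearMap.proj j :
      (Fin N → 𝕜) →L[𝕜] 𝕜).smulRight (vacuumCoeff p a b i j)).hasFDerivAt
  · exact (h₂.differentiableAt x hx (p i)).hasFDerivAt.const_mul _
  · exact (h₁.differentiableAt x hx (p i)).hasFDerivAt.const_mul _

theorem contDiffOn_potentialGradient (hU : IsOpen U) (h₁ : IsC1Family U T₁)
    (h₂ : IsC1Family U T₂) (i : Fin N) :
    ContDiffOn 𝕜 1 (potentialGradient p a b T₁ T₂ i) U := by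
  have h : ∀ T, IsC1Family U T → ContDiffOn 𝕜 1 (fun x => T x (p i)) U := by
    intro T hT
    rw [show (1 : WithTop ℕ∞) = 0 + 1 by norm_num, contDiffOn_succ_iff_fderiv_of_isOpen hU]
    refine ⟨fun x hx => (hT.differentiableAt x hx (p i)).differentiableWithinAt, by simp, ?_⟩
    rw [contDiffOn_zero]
    exact hT.continuousOn_fderiv.comp (by fun_prop : Continuous fun x : Fin N → 𝕜 =>
      (x, p i)).continuousOn fun x hx => ⟨hx, mem_univ _⟩
  refine ContDiffOn.add ?_ ((contDiffOn_const.mul (h T₂ h₂)).sub (contDiffOn_const.mul (h T₁ h₁)))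
  exact (ContDiff.sum fun j _ => ((ContinuousLinearMap.proj j :
      (Fin N → 𝕜) →L[𝕜] 𝕜).smulRight (vacuumCoeff p a b i j)).contDiff).contDiffOn

theorem IsDbarSolution.hasFDerivAt_potential (hT : IsDbarSolution G D W p a b U T₁ T₂)
    (hW : IsHamiltonian G D W) (hG : MeasurableSet G) (hGb : Bornology.IsBounded G)
    (hpG : ∀ i, p i ∉ closure G) (hU : IsOpen U) {x : Fin N → 𝕜} (hx : x ∈ U) :
    HasFDerivAt (potential G W p a b T₁ T₂)
      (∑ i, (ContinuousLinearMap.proj i : (Fin N → 𝕜) →L[𝕜] 𝕜).smulRight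
        (potentialGradient p a b T₁ T₂ i x)) x := by
  refine hasFDerivAt_of_hasDerivAt_line (f := potential G W p a b T₁ T₂)
    (L := fun x => ∑ i, (ContinuousLinearMap.proj i : (Fin N → 𝕜) →L[𝕜] 𝕜).smulRight
        (potentialGradient p a b T₁ T₂ i x)) hU ?_ (fun x hx v => ?_) hx
  · refine continuousOn_finsetSum _ fun i _ => ?_
    exact (ContinuousLinearMap.smulRightL 𝕜 (Fin N → 𝕜) ℂ
      (ContinuousLinearMap.proj i)).continuous.comp_continuousOn
        (contDiffOn_potentialGradient hU hT.family₁ hT.family₂ i).continuousOn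
  · refine ((hasDerivAt_vacuumPotential p a b x v).add
      (hT.hasDerivAt_action hW hG hGb hpG hU hx v)).congr_deriv ?_
    simp [potentialGradient, smul_add, Finset.sum_add_distrib]

theorem IsDbarSolution.pd_potential (hT : IsDbarSolution G D W p a b U T₁ T₂)
    (hW : IsHamiltonian G D W) (hG : MeasurableSet G) (hGb : Bornology.IsBounded G)
    (hpG : ∀ i, p i ∉ closure G) (hU : IsOpen U) {x : Fin N → 𝕜} (hx : x ∈ U) (i : Fin N) :
    pd i (potential G W p a b T₁ T₂) x = potentialGradient p a b T₁ T₂ i x := by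
  rw [pd, (hT.hasFDerivAt_potential hW hG hGb hpG hU hx).fderiv, sum_apply,
    Finset.sum_eq_single i]
  · simp
  · intro j _ hj
    simp [hj]
  · simp

theorem IsDbarSolution.pd_pd_potential (hT : IsDbarSolution G D W p a b U T₁ T₂)
    (hW : IsHamiltonian G D W) (hG : MeasurableSet G) (hGb : Bornology.IsBounded G)
    (hpG : ∀ i, p i ∉ closure G) (hU : IsOpen U) {x : Fin N → 𝕜} (hx : x ∈ U) (i j : Fin N) :
    pd i (pd j (potential G W p a b T₁ T₂)) x = vacuumCoeff p a b j i
      + (a j * pd i (fun y => T₂ y (p j)) x - b j * pd i (fun y => T₁ y (p j)) x) := by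
  have h1 : pd j (potential G W p a b T₁ T₂) =ᶠ[𝓝 x] potentialGradient p a b T₁ T₂ j := by
    filter_upwards [hU.mem_nhds hx] with y hy
    exact hT.pd_potential hW hG hGb hpG hU hy j
  rw [pd, h1.fderiv_eq, (hasFDerivAt_potentialGradient hT.family₁ hT.family₂ j hx).fderiv,
    add_apply, sum_apply, Finset.sum_eq_single i]
  · simp [pd]
  · intro k _ hk
    simp [hk]
  · simp

theorem IsDbarSolution.contDiffOn_potential (hT : IsDbarSolution G D W p a b U T₁ T₂)
    (hW : IsHamiltonian G D W) (hG : MeasurableSet G) (hGb : Bornology.IsBounded G)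
    (hpG : ∀ i, p i ∉ closure G) (hU : IsOpen U) :
    ContDiffOn 𝕜 2 (potential G W p a b T₁ T₂) U := by
  rw [show (2 : WithTop ℕ∞) = 1 + 1 by norm_num, contDiffOn_succ_iff_fderiv_of_isOpen hU]
  refine ⟨fun x hx => (hT.hasFDerivAt_potential hW hG hGb hpG hU
    hx).differentiableAt.differentiableWithinAt, by simp, ?_⟩
  have h : ContDiffOn 𝕜 1 (fun x => ∑ i, (ContinuousLinearMap.proj i :
      (Fin N → 𝕜) →L[𝕜] 𝕜).smulRight (potentialGradient p a b T₁ T₂ i x)) U :=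
    ContDiffOn.sum fun i _ => (ContinuousLinearMap.smulRightL 𝕜 (Fin N → 𝕜) ℂ
      (ContinuousLinearMap.proj i)).contDiff.comp_contDiffOn
        (contDiffOn_potentialGradient hU hT.family₁ hT.family₂ i)
  exact h.congr fun x hx => (hT.hasFDerivAt_potential hW hG hGb hpG hU hx).fderiv

theorem IsDbarSolution.pd_pd_potential_symm (hT : IsDbarSolution G D W p a b U T₁ T₂)
    (hW : IsHamiltonian G D W) (hG : MeasurableSet G) (hGb : Bornology.IsBounded G)
    (hpG : ∀ i, p i ∉ closure G) (hU : IsOpen U) {x : Fin N → 𝕜} (hx : x ∈ U) (i j : Fin N) :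
    pd i (pd j (potential G W p a b T₁ T₂)) x = pd j (pd i (potential G W p a b T₁ T₂)) x := by
  have h1 : ContDiffAt 𝕜 2 (potential G W p a b T₁ T₂) x :=
    (hT.contDiffOn_potential hW hG hGb hpG hU).contDiffAt (hU.mem_nhds hx)
  have h2 : DifferentiableAt 𝕜 (fderiv 𝕜 (potential G W p a b T₁ T₂)) x :=
    (h1.fderiv_right (m := 1) (by norm_num)).differentiableAt (by norm_num)
  have h3 : ∀ i j, pd i (pd j (potential G W p a b T₁ T₂)) x
      = fderiv 𝕜 (fderiv 𝕜 (potential G W p a b T₁ T₂)) x (Pi.single i 1) (Pi.single j 1) := by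
    intro i j
    have h4 := (h2.hasFDerivAt.clm_apply
      (hasFDerivAt_const (Pi.single j (1 : 𝕜)) x)).fderiv
    have h5 : pd i (pd j (potential G W p a b T₁ T₂)) x = fderiv 𝕜
      (fun y => fderiv 𝕜 (potential G W p a b T₁ T₂) y (Pi.single j 1)) x (Pi.single i 1) := rfl
    rw [h5, h4]
    simp
  rw [h3, h3]
  exact h1.isSymmSndFDerivAt (by simp) _ _

end Potential

/-! ### The two-form and the heavenly equations -/

section TwoForm

variable {𝕜 : Type*} [RCLike 𝕜] [NormedAlgebra 𝕜 ℂ] {N : ℕ} {G : Set ℂ} {D : Set (ℂ × ℂ × ℂ)}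
  {W : ℂ → ℂ → ℂ → ℂ} {p a b : Fin N → ℂ} {U : Set (Fin N → 𝕜)} {T₁ T₂ : (Fin N → 𝕜) → ℂ → ℂ}

/-- The two-form `dS₁ ∧ dS₂` has no `∂̄` in `G`: the linearized equations are Hamiltonian, with
symmetric Hessian `D²W`. -/
theorem IsDbarSolution.sourceDeriv_symplectic (hT : IsDbarSolution G D W p a b U T₁ T₂)
    (hW : IsHamiltonian G D W) (hGb : Bornology.IsBounded G) (hpG : ∀ i, p i ∉ closure G)
    (hU : IsOpen U) {x : Fin N → 𝕜} (hx : x ∈ U) (s s' : ℂ → ℂ × ℂ) (z : ℂ) :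
    (s' z).2 * sourceDeriv G W (field p a b T₁ T₂ x) s (0, 1) z
      + (s z).1 * sourceDeriv G W (field p a b T₁ T₂ x) s' (-1, 0) z
      - (s z).2 * sourceDeriv G W (field p a b T₁ T₂ x) s' (0, 1) z
      - (s' z).1 * sourceDeriv G W (field p a b T₁ T₂ x) s (-1, 0) z = 0 := by
  by_cases hz : z ∈ G
  · obtain ⟨δ, hδ, B, hB, hb⟩ := hT.exists_local_bound hW hGb hpG hU hx 0
    have hsymm := ((hb 0 (Metric.mem_ball_self hδ)).2 z hz).1.2.2.2.2.2
    rw [smul_zero, add_zero] at hsymm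
    simp only [sourceDeriv, indicator_of_mem hz]
    set H := fderiv ℂ (fderiv ℂ fun σ : ℂ × ℂ => W z σ.1 σ.2) (field p a b T₁ T₂ x z)
    have e : ∀ s u : ℂ × ℂ, H u s = s.2 * H u (0, 1) - s.1 * H u (-1, 0) := by
      intro s u
      have e1 : s = s.2 • ((0, 1) : ℂ × ℂ) - s.1 • ((-1, 0) : ℂ × ℂ) := by ext <;> simp
      have e2 := congrArg (H u) e1
      rwa [map_sub, map_smul, map_smul, smul_eq_mul, smul_eq_mul] at e2
    linear_combination hsymm (s z) (s' z) - e (s' z) (s z) + e (s z) (s' z)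
  · simp only [sourceDeriv, indicator_of_notMem hz]
    ring

/-- The coefficients of `dS₁ ∧ dS₂` are rational functions of `z` with simple poles at `p_i`
and `p_j` and no other singularities. The part quadratic in the derivatives of `T₁`, `T₂` is a
Cauchy transform by the product rule, and its density reduces to the vacuum terms times the derivatives of
the sources. -/
theorem IsDbarSolution.twoForm_eq (hT : IsDbarSolution G D W p a b U T₁ T₂)
    (hW : IsHamiltonian G D W) (hG : MeasurableSet G) (hGb : Bornology.IsBounded G)
    (hpG : ∀ i, p i ∉ closure G)
    (hU : IsOpen U) {x : Fin N → 𝕜} (hx : x ∈ U) (i j : Fin N) {w : ℂ} (hi : w ≠ p i)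
    (hj : w ≠ p j) :
    (a i * (w - p i)⁻¹ + pd i (fun y => T₁ y w) x) * (b j * (w - p j)⁻¹ + pd j (fun y => T₂ y w) x)
      - (a j * (w - p j)⁻¹ + pd j (fun y => T₁ y w) x)
        * (b i * (w - p i)⁻¹ + pd i (fun y => T₂ y w) x)
    = (a i * b j - a j * b i) * ((w - p i)⁻¹ * (w - p j)⁻¹)
      + (w - p i)⁻¹ * (a i * pd j (fun y => T₂ y (p i)) x - b i * pd j (fun y => T₁ y (p i)) x)
      - (w - p j)⁻¹
        * (a j * pd i (fun y => T₂ y (p j)) x - b j * pd i (fun y => T₁ y (p j)) x) := by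
  have h₁ := fun v => hT.fderiv_eq_cauchyTransform hW hG hGb hpG hU hT.family₁
    (fun x hx => hT.hasWeakDbar₁ hW hx) hT.zero_at_infty₁ hx v
  have h₂ := fun v => hT.fderiv_eq_cauchyTransform hW hG hGb hpG hU hT.family₂
    (fun x hx => hT.hasWeakDbar₂ hW hx) hT.zero_at_infty₂ hx v
  have hsym := hT.sourceDeriv_symplectic hW hGb hpG hU hx
    (fieldDeriv p a b T₁ T₂ x (Pi.single i 1)) (fieldDeriv p a b T₁ T₂ x (Pi.single j 1))
  have hc₁ := hT.family₁.continuous_fderiv hx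
  have hc₂ := hT.family₂.continuous_fderiv hx
  simp only [pd]
  set τ₁ : (Fin N → 𝕜) → ℂ → ℂ := fun v z => fderiv 𝕜 (fun y => T₁ y z) x v with hτ₁
  set τ₂ : (Fin N → 𝕜) → ℂ → ℂ := fun v z => fderiv 𝕜 (fun y => T₂ y z) x v with hτ₂
  set ei : Fin N → 𝕜 := Pi.single i 1 with hei
  set ej : Fin N → 𝕜 := Pi.single j 1 with hej
  set g₁ : (Fin N → 𝕜) → ℂ → ℂ := fun v =>
    sourceDeriv G W (field p a b T₁ T₂ x) (fieldDeriv p a b T₁ T₂ x v) (0, 1)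
  set g₂ : (Fin N → 𝕜) → ℂ → ℂ := fun v =>
    sourceDeriv G W (field p a b T₁ T₂ x) (fieldDeriv p a b T₁ T₂ x v) (-1, 0)
  have hg₁ : ∀ v, IsBoundedCompact (g₁ v) := fun v => (h₁ v).1
  have hg₂ : ∀ v, IsBoundedCompact (g₂ v) := fun v => (h₂ v).1
  have ht₁ : ∀ v, cauchyTransform (g₁ v) = τ₁ v := fun v => funext fun z => ((h₁ v).2 z).symm
  have ht₂ : ∀ v, cauchyTransform (g₂ v) = τ₂ v := fun v => funext fun z => ((h₂ v).2 z).symm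
  change (a i * (w - p i)⁻¹ + τ₁ ei w) * (b j * (w - p j)⁻¹ + τ₂ ej w)
      - (a j * (w - p j)⁻¹ + τ₁ ej w) * (b i * (w - p i)⁻¹ + τ₂ ei w)
    = (a i * b j - a j * b i) * ((w - p i)⁻¹ * (w - p j)⁻¹)
      + (w - p i)⁻¹ * (a i * τ₂ ej (p i) - b i * τ₁ ej (p i))
      - (w - p j)⁻¹ * (a j * τ₂ ei (p j) - b j * τ₁ ei (p j))
  have hp₁ : τ₁ ei w * τ₂ ej w
      = cauchyTransform (fun z => τ₂ ej z * g₁ ei z) w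
        + cauchyTransform (fun z => τ₁ ei z * g₂ ej z) w := by
    have := IsBoundedCompact.cauchyTransform_mul_cauchyTransform (hg₁ ei) (hg₂ ej) w
    rwa [ht₁, ht₂] at this
  have hp₂ : τ₁ ej w * τ₂ ei w
      = cauchyTransform (fun z => τ₂ ei z * g₁ ej z) w
        + cauchyTransform (fun z => τ₁ ej z * g₂ ei z) w := by
    have := IsBoundedCompact.cauchyTransform_mul_cauchyTransform (hg₁ ej) (hg₂ ei) w
    rwa [ht₁, ht₂] at this
  -- densities with one vacuum factor have explicit Cauchy transforms
  have hq : ∀ (f : ℂ → ℂ) (_ : IsBoundedCompact f) (k : Fin N), w ≠ p k →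
      Integrable (fun z => ((z - p k)⁻¹ * f z) * (w - z)⁻¹) ∧
      ∫ z, ((z - p k)⁻¹ * f z) * (w - z)⁻¹
        = Real.pi * ((w - p k)⁻¹ * (cauchyTransform f w - cauchyTransform f (p k))) := by
    intro f hf k hk
    refine ⟨hf.integrable_inv_sub_mul_inv hk, ?_⟩
    have hpi : (Real.pi : ℂ) ≠ 0 := by exact_mod_cast Real.pi_ne_zero
    rw [← hf.cauchyTransform_inv_sub_mul hk, cauchyTransform, mul_inv_cancel_left₀ hpi]
  obtain ⟨i1, q1⟩ := hq _ (hg₁ ei) j hj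
  obtain ⟨i2, q2⟩ := hq _ (hg₂ ej) i hi
  obtain ⟨i3, q3⟩ := hq _ (hg₁ ej) i hi
  obtain ⟨i4, q4⟩ := hq _ (hg₂ ei) j hj
  have k1 := ((hg₁ ei).continuous_mul (hc₂ ej)).integrable_mul_inv w
  have k2 := ((hg₂ ej).continuous_mul (hc₁ ei)).integrable_mul_inv w
  have k3 := ((hg₁ ej).continuous_mul (hc₂ ei)).integrable_mul_inv w
  have k4 := ((hg₂ ei).continuous_mul (hc₁ ej)).integrable_mul_inv w
  -- `hsym`, multiplied by the Cauchy kernel and integrated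
  have hsum : (∫ z, (τ₂ ej z * g₁ ei z) * (w - z)⁻¹) + (∫ z, (τ₁ ei z * g₂ ej z) * (w - z)⁻¹)
      - (∫ z, (τ₂ ei z * g₁ ej z) * (w - z)⁻¹) - (∫ z, (τ₁ ej z * g₂ ei z) * (w - z)⁻¹)
      = -(b j * (∫ z, ((z - p j)⁻¹ * g₁ ei z) * (w - z)⁻¹)
        + a i * (∫ z, ((z - p i)⁻¹ * g₂ ej z) * (w - z)⁻¹)
        - b i * (∫ z, ((z - p i)⁻¹ * g₁ ej z) * (w - z)⁻¹)
        - a j * (∫ z, ((z - p j)⁻¹ * g₂ ei z) * (w - z)⁻¹)) := by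
    have r1 := integral_sub ((k1.add k2).sub k3) k4
    have r2 := integral_sub (k1.add k2) k3
    have r3 := integral_add k1 k2
    have l1 := integral_sub (((i1.const_mul (b j)).add (i2.const_mul (a i))).sub
      (i3.const_mul (b i))) (i4.const_mul (a j))
    have l2 := integral_sub ((i1.const_mul (b j)).add (i2.const_mul (a i))) (i3.const_mul (b i))
    have l3 := integral_add (i1.const_mul (b j)) (i2.const_mul (a i))
    simp only [integral_const_mul] at l1 l2 l3
    refine (congrArg₂ (· - ·) ((congrArg₂ (· - ·) r3 rfl).symm.trans r2.symm) rfl).trans ?_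
    refine r1.symm.trans ?_
    refine Eq.trans ?_ (congrArg Neg.neg
      (l1.trans (congrArg₂ (· - ·) (l2.trans (congrArg₂ (· - ·) l3 rfl)) rfl)))
    rw [← integral_neg]
    refine integral_congr_ae (Eventually.of_forall fun z => ?_)
    have h := hsym z
    simp only [fieldDeriv, hei, hej, vacuum_single] at h
    simp only [Pi.add_apply, Pi.sub_apply]
    linear_combination (w - z)⁻¹ * h
  rw [q1, q2, q3, q4, ht₁, ht₁, ht₂, ht₂] at hsum
  have hpi : (Real.pi : ℂ) ≠ 0 := by exact_mod_cast Real.pi_ne_zero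
  simp only [cauchyTransform] at hp₁ hp₂
  have hinv := inv_mul_cancel₀ hpi
  linear_combination hp₁ - hp₂ + (Real.pi : ℂ)⁻¹ * hsum
    - (b j * (w - p j)⁻¹ * (τ₁ ei w - τ₁ ei (p j)) + a i * (w - p i)⁻¹ * (τ₂ ej w - τ₂ ej (p i))
      - b i * (w - p i)⁻¹ * (τ₁ ej w - τ₁ ej (p i))
      - a j * (w - p j)⁻¹ * (τ₂ ei w - τ₂ ei (p j))) * hinv

theorem IsDbarSolution.pd_field (hT : IsDbarSolution G D W p a b U T₁ T₂) {x : Fin N → 𝕜}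
    (hx : x ∈ U) (i : Fin N) (z : ℂ) :
    pd i (fun y => vacuum p a y z + T₁ y z) x
        = a i * (z - p i)⁻¹ + pd i (fun y => T₁ y z) x ∧
      pd i (fun y => vacuum p b y z + T₂ y z) x
        = b i * (z - p i)⁻¹ + pd i (fun y => T₂ y z) x := by
  have h : ∀ (c : Fin N → ℂ) (T : (Fin N → 𝕜) → ℂ → ℂ), IsC1Family U T →
      pd i (fun y => vacuum p c y z + T y z) x
        = c i * (z - p i)⁻¹ + pd i (fun y => T y z) x := by
    intro c T hT
    have h1 : HasFDerivAt (fun y : Fin N → 𝕜 => vacuum p c y z)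
        (∑ k, (ContinuousLinearMap.proj k : (Fin N → 𝕜) →L[𝕜] 𝕜).smulRight (c k / (z - p k))) x :=
      HasFDerivAt.fun_sum fun k _ => ((ContinuousLinearMap.proj k :
        (Fin N → 𝕜) →L[𝕜] 𝕜).smulRight (c k / (z - p k))).hasFDerivAt
    have h2 := (h1.add (hT.differentiableAt x hx z).hasFDerivAt).fderiv
    have h3 : pd i (fun y => vacuum p c y z + T y z) x
      = fderiv 𝕜 ((fun y => vacuum p c y z) + fun y => T y z) x (Pi.single i 1) := rfl
    rw [h3, h2, add_apply, sum_apply, ← vacuum_single (𝕜 := 𝕜) p c i z]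
    rfl
  exact ⟨h a T₁ hT.family₁, h b T₂ hT.family₂⟩

theorem IsDbarSolution.isPotentialOfTwoFormAt (hT : IsDbarSolution G D W p a b U T₁ T₂)
    (hW : IsHamiltonian G D W) (hG : MeasurableSet G) (hGb : Bornology.IsBounded G)
    (hp : Function.Injective p) (hpG : ∀ i, p i ∉ closure G) (hU : IsOpen U) {x : Fin N → 𝕜}
    (hx : x ∈ U) {z : ℂ} (hz : ∀ i, z ≠ p i) :
    IsPotentialOfTwoFormAt p (fun y w => vacuum p a y w + T₁ y w)
      (fun y w => vacuum p b y w + T₂ y w) (potential G W p a b T₁ T₂) x z := by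
  intro i j
  rcases eq_or_ne i j with rfl | hij
  · ring
  rw [(hT.pd_field hx i z).1, (hT.pd_field hx i z).2, (hT.pd_field hx j z).1,
    (hT.pd_field hx j z).2, hT.twoForm_eq hW hG hGb hpG hU hx i j (hz i) (hz j)]
  have h1 := hT.pd_pd_potential hW hG hGb hpG hU hx i j
  have h2 := hT.pd_pd_potential hW hG hGb hpG hU hx j i
  rw [← hT.pd_pd_potential_symm hW hG hGb hpG hU hx i j] at h2
  have e1 : z - p i ≠ 0 := sub_ne_zero.2 (hz i)
  have e2 : z - p j ≠ 0 := sub_ne_zero.2 (hz j)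
  have e3 : p i - p j ≠ 0 := sub_ne_zero.2 (hp.ne hij)
  have e4 : (a i * b j - a j * b i) * ((z - p i)⁻¹ * (z - p j)⁻¹)
      = (z - p i)⁻¹ * vacuumCoeff p a b i j - (z - p j)⁻¹ * vacuumCoeff p a b j i := by
    rw [vacuumCoeff_symm p a b j i, vacuumCoeff]
    field_simp
    ring
  rw [one_div, one_div]
  linear_combination e4 - (z - p i)⁻¹ * h2 + (z - p j)⁻¹ * h1

/-- The heavenly equations are the Plücker relations for the decomposable form `dS₁ ∧ dS₂`. -/
theorem solvesHeavenlyHierarchyAt_of_isPotential {S₁ S₂ : (Fin N → 𝕜) → ℂ → ℂ}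
    {Θ : (Fin N → 𝕜) → ℂ} {x : Fin N → 𝕜} {z : ℂ} (hz : ∀ i, z ≠ p i)
    (h : IsPotentialOfTwoFormAt p S₁ S₂ Θ x z) : SolvesHeavenlyHierarchyAt p Θ x := by
  intro i j k l _ _ _ _ _ _
  have e : ∀ m, z - p m ≠ 0 := fun m => sub_ne_zero.2 (hz m)
  have h' : ∀ i j, (p i - p j) * pd i (pd j Θ) x
      = (z - p i) * (z - p j) * (pd i (fun y => S₁ y z) x * pd j (fun y => S₂ y z) x
        - pd j (fun y => S₁ y z) x * pd i (fun y => S₂ y z) x) := by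
    intro i j
    have e1 := e i
    have e2 := e j
    rw [h i j]
    field_simp
    ring
  have hij := h' i j
  have hkl := h' k l
  have hik := h' i k
  have hjl := h' j l
  have hil := h' i l
  have hjk := h' j k
  have c1 : (p k - p j) * (p l - p i) * pd j (pd k Θ) x * pd i (pd l Θ) x
      = ((p j - p k) * pd j (pd k Θ) x) * ((p i - p l) * pd i (pd l Θ) x) := by ring
  have c2 : (p k - p i) * (p l - p j) * pd i (pd k Θ) x * pd j (pd l Θ) x
      = ((p i - p k) * pd i (pd k Θ) x) * ((p j - p l) * pd j (pd l Θ) x) := by ring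
  have c3 : (p j - p i) * (p l - p k) * pd i (pd j Θ) x * pd k (pd l Θ) x
      = ((p i - p j) * pd i (pd j Θ) x) * ((p k - p l) * pd k (pd l Θ) x) := by ring
  rw [c1, c2, c3, hij, hkl, hik, hjl, hil, hjk]
  ring

end TwoForm

end HeavenlyDressing

theorem proposition2 {𝕜 : Type*} [RCLike 𝕜] [NormedAlgebra 𝕜 ℂ] {N : ℕ}
    (G : Set ℂ) (hG : MeasurableSet G) (hGb : Bornology.IsBounded G)
    (D : Set (ℂ × ℂ × ℂ)) (W : ℂ → ℂ → ℂ → ℂ) (hW : HeavenlyDressing.IsHamiltonian G D W)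
    (p a b : Fin N → ℂ) (hp : Function.Injective p) (hpG : ∀ i, p i ∉ closure G)
    (U : Set (Fin N → 𝕜)) (hU : IsOpen U) (T₁ T₂ : (Fin N → 𝕜) → ℂ → ℂ)
    (hT : HeavenlyDressing.IsDbarSolution G D W p a b U T₁ T₂) :
    (∀ x ∈ U, IntegrableOn (HeavenlyDressing.actionDensity W (HeavenlyDressing.vacuum p a x)
      (HeavenlyDressing.vacuum p b x) (T₁ x) (T₂ x)) G) ∧
    ContDiffOn 𝕜 2 (HeavenlyDressing.potential G W p a b T₁ T₂) U ∧
    (∀ x ∈ U, ∀ z : ℂ, (∀ i, z ≠ p i) →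
      HeavenlyDressing.IsPotentialOfTwoFormAt p
        (fun y w => HeavenlyDressing.vacuum p a y w + T₁ y w)
        (fun y w => HeavenlyDressing.vacuum p b y w + T₂ y w)
        (HeavenlyDressing.potential G W p a b T₁ T₂) x z) ∧
    (∀ x ∈ U, HeavenlyDressing.SolvesHeavenlyHierarchyAt p
      (HeavenlyDressing.potential G W p a b T₁ T₂) x) := by
  refine ⟨fun x hx => hT.integrableOn_actionDensity hW hG hGb hpG hU hx,
    hT.contDiffOn_potential hW hG hGb hpG hU,
    fun x hx z hz => hT.isPotentialOfTwoFormAt hW hG hGb hp hpG hU hx hz, fun x hx => ?_⟩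
  obtain ⟨z, hz⟩ := (Set.finite_range p).exists_notMem
  have hz' : ∀ i, z ≠ p i := fun i h => hz ⟨i, h.symm⟩
  exact HeavenlyDressing.solvesHeavenlyHierarchyAt_of_isPotential hz'
    (hT.isPotentialOfTwoFormAt hW hG hGb hp hpG hU hx hz')
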